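/- Let $\zeta$ denote the Riemann zeta function and let $\mathscr L=\{s\in\mathbb C:\operatorname{Re}s=\tfrac12\}$ be the critical line. A self-intersection of $\zeta$ on the critical line is an element of the set $$\{(s_1,s_2)\in\mathscr L^2: s_1\ne s_2 \text{ and } \zeta(s_1)=\zeta(s_2)\}.$$ The Riemann zeta function has only countably many self-intersections on the critical line, that is, this set is countable (finite or countably infinite). In other words, for all but countably many $z\in\mathbb C$, the equation $\zeta(\tfrac12+it)=z$ has at most one solution $t\in\mathbb R$. -/

import Mathlib

/-- The critical line `{s ∈ ℂ : Re s = 1/2}`. -/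
def criticalLine : Set ℂ := {s : ℂ | s.re = 1 / 2}

/-- The self-intersections of the Riemann zeta function on the critical line: the pairs of
distinct points of the critical line at which the zeta function takes the same value. -/
def zetaSelfIntersections : Set (ℂ × ℂ) :=
  {p : ℂ × ℂ | p.1 ∈ criticalLine ∧ p.2 ∈ criticalLine ∧ p.1 ≠ p.2 ∧
    riemannZeta p.1 = riemannZeta p.2}

open Set Filter Topology

/-! Put F(t) = ζ(1/2 + it) and let θ be the Riemann–Siegel theta function, a continuous argument of
`Gammaℝ` on the critical line. By the functional equation `Gammaℝ` times ζ is real there, so a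
nonzero value F(t) determines θ(t) modulo π. The derivative θ′ is even and strictly increasing on
[0, ∞), with one positive zero τ near 2π. Hence θ has three monotone branches, separated by −τ and
τ.

Fix two branches, with analytic inverses g₁ and g₂, and a phase difference κ = kπ. The coincidences
F(g₁(u)) = F(g₂(u + κ)) are zeros of an analytic function on an interval: they are countable, or the
equality is an identity (`branchCoincidence_or_countable`). Only countably many choices arise, so it
remains to exclude the identities.

Follow an identity to an end c = ±τ of a branch. If the shifted phase of c is interior to the other
branch, then F equals F(g₂(θ + κ)) on one side of c, and θ′(c) = 0 forces F′(c) = 0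
(`BranchCoincidence.deriv_eq_zero`). If no end can be used in this way, then κ = 0 and the branches
are equal or meet at c. Equal branches give no distinct points. Meeting branches would make F
noninjective near c, which again needs F′(c) = 0 (`not_branchCoincidence_of_meet`).

The remaining input is numerical: τ lies in (5.8, 6.4), and ζ′ has no zero on that segment, by
Euler–Maclaurin summation from n = 2 (`deriv_riemannZeta_ne_zero`). -/

/-! ### Real-analytic zeros, inverse branches and their coincidences -/

theorem AnalyticOnNhd.eqOn_zero_or_countable {f : ℝ → ℂ} {U : Set ℝ} (hf : AnalyticOnNhd ℝ f U)
    (hU : IsPreconnected U) : EqOn f 0 U ∨ {x ∈ U | f x = 0}.Countable := by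
  by_cases h : ∃ x ∈ U, ∃ᶠ z in 𝓝[≠] x, f z = 0
  · obtain ⟨x, hx, hx'⟩ := h
    exact .inl (hf.eqOn_zero_of_preconnected_of_frequently_eq_zero hU hx hx')
  · push Not at h
    right
    -- Every zero has a neighbourhood without other zeros; by the Lindelöf property countably many
    -- of these cover the zero set.
    have key : ∀ x ∈ {x ∈ U | f x = 0}, {z | z ≠ x → ¬ f z = 0} ∈ 𝓝[{x ∈ U | f x = 0}] x := by
      intro x hx
      exact mem_nhdsWithin_of_mem_nhds (eventually_nhdsWithin_iff.1 (h x hx.1))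
    obtain ⟨t, -, htc, ht⟩ := TopologicalSpace.countable_cover_nhdsWithin key
    refine htc.mono fun z hz => ?_
    obtain ⟨x, hxt, hx⟩ := mem_iUnion₂.1 (ht hz)
    by_contra hzt
    exact hx (fun h => hzt (h ▸ hxt)) hz.2

/-- `g : J → I` is an analytic inverse of the restriction of `θ` to the open set `I`, and the image
`J` is an open interval. -/
structure InverseBranch (θ : ℝ → ℝ) (I J : Set ℝ) (g : ℝ → ℝ) : Prop where
  isOpen_source : IsOpen I
  isOpen_target : IsOpen J
  ordConnected : J.OrdConnected
  map_source : ∀ a ∈ I, θ a ∈ J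
  left_inv : ∀ a ∈ I, g (θ a) = a
  map_target : ∀ u ∈ J, g u ∈ I
  right_inv : ∀ u ∈ J, θ (g u) = u
  analytic : AnalyticOnNhd ℝ g J

/-- Analyticity of the inverse follows from that of its composition with `θ`, which is locally the
identity, because `θ` has nonzero derivative. -/
theorem exists_inverseBranch {θ : ℝ → ℝ} (hθ : ∀ t, AnalyticAt ℝ θ t) {I J : Set ℝ}
    (hI : IsOpen I) (hJ : IsOpen J) (hJ' : J.OrdConnected) (hinj : InjOn θ I) (himg : θ '' I = J)
    (hder : ∀ t ∈ I, deriv θ t ≠ 0) : ∃ g, InverseBranch θ I J g := by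
  have hleft : ∀ a ∈ I, Function.invFunOn θ I (θ a) = a := fun a ha =>
    hinj.leftInvOn_invFunOn ha
  refine ⟨Function.invFunOn θ I, hI, hJ, hJ', ?_, hleft, ?_, ?_, ?_⟩
  · rintro a ha
    exact himg ▸ mem_image_of_mem θ ha
  · rintro u hu
    exact Function.invFunOn_mem (himg ▸ hu : u ∈ θ '' I)
  · rintro u hu
    exact Function.invFunOn_eq (himg ▸ hu : u ∈ θ '' I)
  · intro u hu
    obtain ⟨a, ha, rfl⟩ : u ∈ θ '' I := himg ▸ hu
    rw [← analyticAt_comp_iff_of_deriv_ne_zero (hθ a) (hder a ha)]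
    refine analyticAt_id.congr ?_
    filter_upwards [hI.mem_nhds ha] with b hb
    exact (hleft b hb).symm

section Coincidences

variable {F : ℝ → ℂ} {θ : ℝ → ℝ} {I₁ I₂ J₁ J₂ : Set ℝ} {g₁ g₂ : ℝ → ℝ} {κ : ℝ}

/-- The values of `F` agree at all pairs of points of two branches of `θ` whose phases differ
by `κ`, and there is such a pair. -/
def BranchCoincidence (F : ℝ → ℂ) (J₁ J₂ : Set ℝ) (g₁ g₂ : ℝ → ℝ) (κ : ℝ) : Prop :=
  (∃ u ∈ J₁, u + κ ∈ J₂) ∧ ∀ u ∈ J₁, u + κ ∈ J₂ → F (g₁ u) = F (g₂ (u + κ))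

theorem BranchCoincidence.symm (h : BranchCoincidence F J₁ J₂ g₁ g₂ κ) :
    BranchCoincidence F J₂ J₁ g₂ g₁ (-κ) := by
  obtain ⟨⟨u, hu, hu'⟩, h⟩ := h
  refine ⟨⟨u + κ, hu', by simpa using hu⟩, fun v hv hv' => ?_⟩
  have := h (v + -κ) hv' (by simpa using hv)
  simpa using this.symm

/-- The phase `u` of the first point parametrizes the pairs, and the admissible `u` form an
interval, on which the difference of the two values is analytic. -/
theorem branchCoincidence_or_countable (hF : ∀ t, AnalyticAt ℝ F t)
    (h₁ : InverseBranch θ I₁ J₁ g₁) (h₂ : InverseBranch θ I₂ J₂ g₂) (κ : ℝ) :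
    BranchCoincidence F J₁ J₂ g₁ g₂ κ ∨
      {x : ℝ × ℝ | x.1 ∈ I₁ ∧ x.2 ∈ I₂ ∧ θ x.2 = θ x.1 + κ ∧ F x.1 = F x.2}.Countable := by
  set U : Set ℝ := J₁ ∩ (fun u => u + κ) ⁻¹' J₂ with hU
  have hUc : U.OrdConnected :=
    h₁.ordConnected.inter (h₂.ordConnected.preimage_mono fun _ _ h => by gcongr)
  have han : AnalyticOnNhd ℝ (fun u => F (g₁ u) - F (g₂ (u + κ))) U := by
    intro u hu
    have hg₂ : AnalyticAt ℝ (fun u => g₂ (u + κ)) u :=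
      AnalyticAt.fun_comp (f := fun u => u + κ) (h₂.analytic _ hu.2) (by fun_prop)
    exact ((hF _).fun_comp (h₁.analytic u hu.1)).sub ((hF _).fun_comp hg₂)
  rcases han.eqOn_zero_or_countable hUc.isPreconnected with h | h
  · by_cases hne : U.Nonempty
    · obtain ⟨u, hu, hu'⟩ := hne
      exact .inl ⟨⟨u, hu, hu'⟩, fun v hv hv' => sub_eq_zero.1 (h ⟨hv, hv'⟩)⟩
    · right
      convert! countable_empty
      refine eq_empty_of_forall_notMem fun x hx => hne ⟨θ x.1, h₁.map_source _ hx.1, ?_⟩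
      have := h₂.map_source _ hx.2.1
      rwa [hx.2.2.1] at this
  · right
    refine (h.image fun u => (g₁ u, g₂ (u + κ))).mono ?_
    rintro ⟨a, b⟩ ⟨ha, hb, hab, hFab⟩
    dsimp only at ha hb hab hFab
    have e₂ : g₂ (θ a + κ) = b := by rw [← hab, h₂.left_inv b hb]
    refine ⟨θ a, ⟨⟨h₁.map_source a ha, ?_⟩, ?_⟩, ?_⟩
    · have := h₂.map_source b hb
      rwa [hab] at this
    · simp only [h₁.left_inv a ha, e₂, hFab, sub_self]
    · simp only [h₁.left_inv a ha, e₂]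

/-- If `θ` is critical at an endpoint `c` of the first branch while `θ c + κ` lies on the second
branch, then a coincidence forces `F` to be critical at `c`. -/
theorem BranchCoincidence.deriv_eq_zero (hF : ∀ t, AnalyticAt ℝ F t)
    (hθ : ∀ t, AnalyticAt ℝ θ t) (h₁ : InverseBranch θ I₁ J₁ g₁) (h₂ : InverseBranch θ I₂ J₂ g₂)
    (h : BranchCoincidence F J₁ J₂ g₁ g₂ κ) {c : ℝ} {S : Set ℝ} (hS : UniqueDiffWithinAt ℝ S c)
    (hI : I₁ ∈ 𝓝[S] c) (hθc : deriv θ c = 0) (hc : θ c + κ ∈ J₂) : deriv F c = 0 := by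
  have hβ : HasDerivAt (fun a => g₂ (θ a + κ)) 0 c := by
    have e₁ : HasDerivAt (fun a => θ a + κ) 0 c := by
      simpa [hθc] using (hθ c).differentiableAt.hasDerivAt.add_const κ
    simpa [Function.comp_def] using! (h₂.analytic _ hc).differentiableAt.hasDerivAt.comp c e₁
  have hFβ : HasDerivAt (fun a => F (g₂ (θ a + κ))) 0 c := by
    simpa [Function.comp_def] using! HasDerivAt.scomp c (hF (g₂ (θ c + κ))).differentiableAt.hasDerivAt hβ
  have heq : ∀ᶠ a in 𝓝[S] c, F a = F (g₂ (θ a + κ)) := by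
    have hcont : ∀ᶠ a in 𝓝 c, θ a + κ ∈ J₂ :=
      ((hθ c).continuousAt.add continuousAt_const).eventually_mem (h₂.isOpen_target.mem_nhds hc)
    filter_upwards [hI, mem_nhdsWithin_of_mem_nhds hcont] with a ha ha'
    simpa [h₁.left_inv a ha] using h.2 (θ a) (h₁.map_source a ha) ha'
  have hne : (𝓝[S] c).NeBot := mem_closure_iff_nhdsWithin_neBot.1 hS.mem_closure
  -- The point `c` need not lie in `I₁`, so the equality there is a one-sided limit.
  have hFc : F c = F (g₂ (θ c + κ)) := by
    have l₁ : Tendsto F (𝓝[S] c) (𝓝 (F c)) := (hF c).continuousAt.tendsto.mono_left nhdsWithin_le_nhds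
    have l₂ := hFβ.continuousAt.tendsto.mono_left (nhdsWithin_le_nhds (s := S))
    exact tendsto_nhds_unique (l₁.congr' heq) l₂
  have hw : HasDerivWithinAt F 0 S c := hFβ.hasDerivWithinAt.congr_of_eventuallyEq heq hFc
  exact hS.eq_deriv S (hF c).differentiableAt.hasDerivAt.hasDerivWithinAt hw

/-- Near `c` the increment of `f` differs from its linear part by at most half the size of the
latter, so it vanishes only trivially. -/
theorem HasStrictDerivAt.eventually_injOn {f : ℝ → ℂ} {f' : ℂ} {c : ℝ}
    (hf : HasStrictDerivAt f f' c) (hf' : f' ≠ 0) : ∃ s ∈ 𝓝 c, InjOn f s := by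
  have hpos : 0 < ‖f'‖ / 2 := by positivity
  have := hf.hasStrictFDerivAt.isLittleO.def hpos
  rw [nhds_prod_eq, Filter.eventually_iff, mem_prod_same_iff] at this
  obtain ⟨s, hs, hs'⟩ := this
  refine ⟨s, hs, fun x hx y hy hxy => ?_⟩
  have h := hs' (mk_mem_prod hx hy)
  simp only [mem_ofPred_eq, hxy, sub_self, zero_sub, norm_neg, ContinuousLinearMap.toSpanSingleton_apply,
    norm_smul] at h
  by_contra hne
  have h0 : 0 < ‖x - y‖ := norm_pos_iff.2 (sub_ne_zero.2 hne)
  have := norm_pos_iff.2 hf'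
  nlinarith

/-- Two branches meeting at a critical point `c` of `θ` cannot coincide with equal phases, unless
`F` is critical at `c`. -/
theorem not_branchCoincidence_of_meet (hF : ∀ t, AnalyticAt ℝ F t)
    (hθ : ∀ t, AnalyticAt ℝ θ t) (h₁ : InverseBranch θ I₁ J₁ g₁) (h₂ : InverseBranch θ I₂ J₂ g₂)
    {c : ℝ} (hFc : deriv F c ≠ 0) (hI₁ : I₁ ∈ 𝓝[<] c) (hI₂ : I₂ ∈ 𝓝[>] c)
    (hext : (∀ t ∈ I₁ ∪ I₂, θ t < θ c) ∨ (∀ t ∈ I₁ ∪ I₂, θ c < θ t)) :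
    ¬ BranchCoincidence F J₁ J₂ g₁ g₂ 0 := by
  rintro ⟨-, h⟩
  have hcont : Continuous θ := continuous_iff_continuousAt.2 fun t => (hθ t).continuousAt
  obtain ⟨s, hs, hinj⟩ := (hF c).hasStrictDerivAt.eventually_injOn hFc
  obtain ⟨a, ha, hac⟩ := (mem_nhdsLT_iff_exists_Ioo_subset).1
    (inter_mem hI₁ (mem_nhdsWithin_of_mem_nhds hs))
  obtain ⟨b, hb, hcb⟩ := (mem_nhdsGT_iff_exists_Ioo_subset).1
    (inter_mem hI₂ (mem_nhdsWithin_of_mem_nhds hs))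
  obtain ⟨a', haa', ha'c⟩ := exists_between (mem_Iio.1 ha)
  obtain ⟨b', hcb', hb'b⟩ := exists_between (mem_Ioi.1 hb)
  have ha'm := hac ⟨haa', ha'c⟩
  have hb'm := hcb ⟨hcb', hb'b⟩
  -- Since `θ` has a one-sided extremum at `c`, the intermediate value theorem gives points on both
  -- sides of `c` with equal phase.
  obtain ⟨x, hx, y, hy, hxy⟩ : ∃ x ∈ Ioo a c, ∃ y ∈ Ioo c b, θ x = θ y := by
    rcases hext with hext | hext
    · have h1 := hext a' (.inl ha'm.1)
      have h2 := hext b' (.inr hb'm.1)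
      obtain ⟨u, hu, hu'⟩ := exists_between (max_lt h1 h2)
      rw [max_lt_iff] at hu
      obtain ⟨x, hx, hxu⟩ := intermediate_value_Ioo ha'c.le hcont.continuousOn ⟨hu.1, hu'⟩
      obtain ⟨y, hy, hyu⟩ := intermediate_value_Ioo' hcb'.le hcont.continuousOn ⟨hu.2, hu'⟩
      exact ⟨x, ⟨haa'.trans hx.1, hx.2⟩, y, ⟨hy.1, hy.2.trans hb'b⟩, hxu.trans hyu.symm⟩
    · have h1 := hext a' (.inl ha'm.1)
      have h2 := hext b' (.inr hb'm.1)
      obtain ⟨u, hu', hu⟩ := exists_between (lt_min h1 h2)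
      rw [lt_min_iff] at hu
      obtain ⟨x, hx, hxu⟩ := intermediate_value_Ioo' ha'c.le hcont.continuousOn ⟨hu', hu.1⟩
      obtain ⟨y, hy, hyu⟩ := intermediate_value_Ioo hcb'.le hcont.continuousOn ⟨hu', hu.2⟩
      exact ⟨x, ⟨haa'.trans hx.1, hx.2⟩, y, ⟨hy.1, hy.2.trans hb'b⟩, hxu.trans hyu.symm⟩
  have hxm := hac hx
  have hym := hcb hy
  have hy' := h₂.map_source y hym.1
  have := h (θ x) (h₁.map_source x hxm.1) (by simpa [hxy] using hy')
  rw [h₁.left_inv x hxm.1, hxy, add_zero, h₂.left_inv y hym.1] at this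
  exact (hx.2.trans hy.1).ne (hinj hxm.2 hym.2 this)

end Coincidences

/-! ### Countability from the shape of the phase -/

/-- Let `θ` increase up to `p`, decrease on `[p, q]` and increase from `q` on, and suppose that it is
determined modulo `π` by every nonzero value of `F`. If `F` is not critical at the critical points
`p` and `q` of `θ`, then `F` has only countably many self-intersections. -/
theorem countable_selfIntersections_of_phase {F : ℝ → ℂ} {θ : ℝ → ℝ}
    (hF : ∀ t, AnalyticAt ℝ F t) (hθ : ∀ t, AnalyticAt ℝ θ t) {p q : ℝ} (hpq : p < q)
    (h₁ : ∀ t < p, 0 < deriv θ t) (h₂ : ∀ t ∈ Ioo p q, deriv θ t < 0)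
    (h₃ : ∀ t > q, 0 < deriv θ t) (hp : deriv θ p = 0) (hq : deriv θ q = 0)
    (hbot : Tendsto θ atBot atBot) (htop : Tendsto θ atTop atTop)
    (hFp : deriv F p ≠ 0) (hFq : deriv F q ≠ 0)
    (hrel : ∀ a b, F a = F b → F a ≠ 0 → ∃ k : ℤ, θ b = θ a + k * Real.pi) :
    {x : ℝ × ℝ | x.1 ≠ x.2 ∧ F x.1 = F x.2}.Countable := by
  have hcont : Continuous θ := continuous_iff_continuousAt.2 fun t => (hθ t).continuousAt
  have m₁ : StrictMonoOn θ (Iic p) :=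
    strictMonoOn_of_deriv_pos (convex_Iic p) hcont.continuousOn (by simpa using h₁)
  have m₂ : StrictAntiOn θ (Icc p q) :=
    strictAntiOn_of_deriv_neg (convex_Icc p q) hcont.continuousOn (by simpa using h₂)
  have m₃ : StrictMonoOn θ (Ici q) :=
    strictMonoOn_of_deriv_pos (convex_Ici q) hcont.continuousOn (by simpa using h₃)
  have i₁ : θ '' Iio p = Iio (θ p) := by
    refine Subset.antisymm ?_ fun u hu => ?_
    · rintro _ ⟨a, ha, rfl⟩
      exact m₁ (mem_Iic.2 (le_of_lt ha)) self_mem_Iic ha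
    · obtain ⟨a, ha, hap⟩ := ((hbot.eventually (eventually_lt_atBot u)).and
        (eventually_lt_atBot p)).exists
      obtain ⟨x, hx, hxu⟩ := intermediate_value_Ioo hap.le hcont.continuousOn ⟨ha, hu⟩
      exact ⟨x, hx.2, hxu⟩
  have i₂ : θ '' Ioo p q = Ioo (θ q) (θ p) := by
    refine Subset.antisymm ?_ (intermediate_value_Ioo' hpq.le hcont.continuousOn)
    rintro _ ⟨a, ha, rfl⟩
    exact ⟨m₂ ⟨ha.1.le, ha.2.le⟩ (right_mem_Icc.2 hpq.le) ha.2,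
      m₂ (left_mem_Icc.2 hpq.le) ⟨ha.1.le, ha.2.le⟩ ha.1⟩
  have i₃ : θ '' Ioi q = Ioi (θ q) := by
    refine Subset.antisymm ?_ fun u hu => ?_
    · rintro _ ⟨a, ha, rfl⟩
      exact m₃ self_mem_Ici (mem_Ici.2 (le_of_lt ha)) ha
    · obtain ⟨a, ha, hap⟩ := ((htop.eventually (eventually_gt_atTop u)).and
        (eventually_gt_atTop q)).exists
      obtain ⟨x, hx, hxu⟩ := intermediate_value_Ioo hap.le hcont.continuousOn ⟨hu, ha⟩
      exact ⟨x, hx.1, hxu⟩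
  obtain ⟨g₁, b₁⟩ := exists_inverseBranch hθ isOpen_Iio isOpen_Iio ordConnected_Iio
    (m₁.injOn.mono Iio_subset_Iic_self) i₁ fun t ht => (h₁ t ht).ne'
  obtain ⟨g₂, b₂⟩ := exists_inverseBranch hθ isOpen_Ioo isOpen_Ioo ordConnected_Ioo
    (m₂.injOn.mono Ioo_subset_Icc_self) i₂ fun t ht => (h₂ t ht).ne
  obtain ⟨g₃, b₃⟩ := exists_inverseBranch hθ isOpen_Ioi isOpen_Ioi ordConnected_Ioi
    (m₃.injOn.mono Ioi_subset_Ici_self) i₃ fun t ht => (h₃ t ht).ne'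
  -- coincidences that contradict `hFp` or `hFq`
  have e₁ {I J g κ} (b : InverseBranch θ I J g)
      (h : BranchCoincidence F (Iio (θ p)) J g₁ g κ) : θ p + κ ∉ J := fun hJ =>
    hFp (h.deriv_eq_zero hF hθ b₁ b (uniqueDiffWithinAt_Iio p) self_mem_nhdsWithin hp hJ)
  have e₂ {I J g κ} (b : InverseBranch θ I J g)
      (h : BranchCoincidence F (Ioo (θ q) (θ p)) J g₂ g κ) : θ p + κ ∉ J := fun hJ =>
    hFp (h.deriv_eq_zero hF hθ b₂ b (uniqueDiffWithinAt_Ioi p) (Ioo_mem_nhdsGT hpq) hp hJ)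
  have e₂' {I J g κ} (b : InverseBranch θ I J g)
      (h : BranchCoincidence F (Ioo (θ q) (θ p)) J g₂ g κ) : θ q + κ ∉ J := fun hJ =>
    hFq (h.deriv_eq_zero hF hθ b₂ b (uniqueDiffWithinAt_Iio q) (Ioo_mem_nhdsLT hpq) hq hJ)
  have e₃ {I J g κ} (b : InverseBranch θ I J g)
      (h : BranchCoincidence F (Ioi (θ q)) J g₃ g κ) : θ q + κ ∉ J := fun hJ =>
    hFq (h.deriv_eq_zero hF hθ b₃ b (uniqueDiffWithinAt_Ioi q) self_mem_nhdsWithin hq hJ)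
  -- A nonzero shift moves the end of the phase interval inside for one sign of `κ`; `symm` treats
  -- the other sign.
  have c₁₁ (κ : ℝ) (hκ : κ ≠ 0) : ¬ BranchCoincidence F (Iio (θ p)) (Iio (θ p)) g₁ g₁ κ := by
    intro h
    rcases hκ.lt_or_gt with hκ | hκ
    · exact e₁ b₁ h (by simpa using hκ)
    · exact e₁ b₁ h.symm (by simpa using hκ)
  have c₂₂ (κ : ℝ) (hκ : κ ≠ 0) :
      ¬ BranchCoincidence F (Ioo (θ q) (θ p)) (Ioo (θ q) (θ p)) g₂ g₂ κ := by
    intro h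
    obtain ⟨u, hu, hu'⟩ := h.1
    simp only [mem_Ioo] at hu hu'
    rcases hκ.lt_or_gt with hκ | hκ
    · exact e₂ b₂ h ⟨by linarith, by linarith⟩
    · exact e₂ b₂ h.symm ⟨by linarith, by linarith⟩
  have c₃₃ (κ : ℝ) (hκ : κ ≠ 0) : ¬ BranchCoincidence F (Ioi (θ q)) (Ioi (θ q)) g₃ g₃ κ := by
    intro h
    rcases hκ.lt_or_gt with hκ | hκ
    · exact e₃ b₃ h.symm (by simpa using hκ)
    · exact e₃ b₃ h (by simpa using hκ)
  -- For `κ < 0` the end `p` of the first branch lands inside the second, for `κ > 0` the reverse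
  -- holds, and for `κ = 0` the branches meet at `p`.
  have c₁₂ (κ : ℝ) : ¬ BranchCoincidence F (Iio (θ p)) (Ioo (θ q) (θ p)) g₁ g₂ κ := by
    intro h
    obtain ⟨u, hu, hu'⟩ := h.1
    simp only [mem_Iio, mem_Ioo] at hu hu'
    rcases lt_trichotomy κ 0 with hκ | rfl | hκ
    · exact e₁ b₂ h ⟨by linarith, by linarith⟩
    · refine not_branchCoincidence_of_meet hF hθ b₁ b₂ hFp self_mem_nhdsWithin
        (Ioo_mem_nhdsGT hpq) (.inl ?_) h
      rintro t (ht | ht)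
      · exact b₁.map_source t ht
      · exact (b₂.map_source t ht).2
    · exact e₂ b₁ h.symm (by simpa using hκ)
  have c₂₃ (κ : ℝ) : ¬ BranchCoincidence F (Ioo (θ q) (θ p)) (Ioi (θ q)) g₂ g₃ κ := by
    intro h
    obtain ⟨u, hu, hu'⟩ := h.1
    simp only [mem_Ioi, mem_Ioo] at hu hu'
    rcases lt_trichotomy κ 0 with hκ | rfl | hκ
    · exact e₃ b₂ h.symm ⟨by linarith, by linarith⟩
    · refine not_branchCoincidence_of_meet hF hθ b₂ b₃ hFq (Ioo_mem_nhdsLT hpq)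
        self_mem_nhdsWithin (.inr ?_) h
      rintro t (ht | ht)
      · exact (b₂.map_source t ht).1
      · exact b₃.map_source t ht
    · exact e₂' b₃ h (by simpa using hκ)
  have c₁₃ (κ : ℝ) : ¬ BranchCoincidence F (Iio (θ p)) (Ioi (θ q)) g₁ g₃ κ := by
    intro h
    obtain ⟨u, hu, hu'⟩ := h.1
    simp only [mem_Ioi, mem_Iio] at hu hu'
    -- No case distinction: the overlap of the phase intervals already gives `θ p + κ > θ q`.
    exact e₁ b₃ h (by simp only [mem_Ioi]; linarith)
  have c₂₁ (κ : ℝ) : ¬ BranchCoincidence F (Ioo (θ q) (θ p)) (Iio (θ p)) g₂ g₁ κ :=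
    fun h => c₁₂ _ h.symm
  have c₃₂ (κ : ℝ) : ¬ BranchCoincidence F (Ioi (θ q)) (Ioo (θ q) (θ p)) g₃ g₂ κ :=
    fun h => c₂₃ _ h.symm
  have c₃₁ (κ : ℝ) : ¬ BranchCoincidence F (Ioi (θ q)) (Iio (θ p)) g₃ g₁ κ :=
    fun h => c₁₃ _ h.symm
  have count {I J I' J' g g' κ} (b : InverseBranch θ I J g) (b' : InverseBranch θ I' J' g')
      (h : ¬ BranchCoincidence F J J' g g' κ) :
      {x : ℝ × ℝ | x.1 ∈ I ∧ x.2 ∈ I' ∧ θ x.2 = θ x.1 + κ ∧ F x.1 = F x.2}.Countable :=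
    (branchCoincidence_or_countable hF b b' κ).resolve_left h
  have same {I J g} (b : InverseBranch θ I J g)
      (h : ∀ κ : ℝ, κ ≠ 0 → ¬ BranchCoincidence F J J g g κ) (κ : ℝ) :
      {x : ℝ × ℝ | x.1 ∈ I ∧ x.2 ∈ I ∧ θ x.2 = θ x.1 + κ ∧ x.1 ≠ x.2 ∧ F x.1 = F x.2}.Countable := by
    rcases eq_or_ne κ 0 with rfl | hκ
    · convert! countable_empty
      refine eq_empty_of_forall_notMem ?_
      rintro ⟨x, y⟩ ⟨hx, hy, hxy, hne, -⟩
      dsimp only at hx hy hxy hne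
      apply hne
      rw [← b.left_inv x hx, ← b.left_inv y hy, hxy, add_zero]
    · refine (count b b (h κ hκ)).mono ?_
      rintro x ⟨hx, hy, hxy, -, hF'⟩
      exact ⟨hx, hy, hxy, hF'⟩
  -- `F` is not constant, because its derivative at `p` is nonzero.
  have fibre (z : ℂ) : {t | F t = z}.Countable := by
    have han : AnalyticOnNhd ℝ (fun t => F t - z) univ := fun t _ => (hF t).sub analyticAt_const
    rcases han.eqOn_zero_or_countable isPreconnected_univ with h | h
    · refine absurd ?_ hFp
      have : F = fun _ => z := funext fun t => sub_eq_zero.1 (h (mem_univ t))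
      simp [this]
    · simpa [sub_eq_zero] using h
  have exceptional (P : ℝ → Prop) (hP : {t | P t}.Countable) :
      {x : ℝ × ℝ | (P x.1 ∨ P x.2) ∧ F x.1 = F x.2}.Countable := by
    have h1 : (⋃ t ∈ {t | P t}, (fun s => (t, s)) '' {s | F s = F t}).Countable :=
      hP.biUnion fun t _ => (fibre (F t)).image _
    have h2 : (⋃ t ∈ {t | P t}, (fun s => (s, t)) '' {s | F s = F t}).Countable :=
      hP.biUnion fun t _ => (fibre (F t)).image _
    refine (h1.union h2).mono ?_
    rintro ⟨x, y⟩ ⟨h | h, hxy⟩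
    · exact .inl (mem_iUnion₂.2 ⟨x, h, y, hxy.symm, rfl⟩)
    · exact .inr (mem_iUnion₂.2 ⟨y, h, x, hxy, rfl⟩)
  have hcrit := exceptional (fun t => t = p ∨ t = q) ((countable_singleton q).insert p)
  -- Zeros of `F` carry no phase information and are set aside with the critical points.
  have hzero := exceptional (fun t => F t = 0) (fibre 0)
  have all_phases {A B : Set ℝ} (h : ∀ κ : ℝ, {x : ℝ × ℝ | x.1 ∈ A ∧ x.2 ∈ B ∧
      θ x.2 = θ x.1 + κ ∧ x.1 ≠ x.2 ∧ F x.1 = F x.2}.Countable) :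
      {x : ℝ × ℝ | x.1 ∈ A ∧ x.2 ∈ B ∧ x.1 ≠ x.2 ∧ F x.1 = F x.2 ∧ F x.1 ≠ 0}.Countable := by
    refine (countable_iUnion fun k : ℤ => h (k * Real.pi)).mono ?_
    rintro x ⟨hx, hy, hne, hxy, h0⟩
    obtain ⟨k, hk⟩ := hrel x.1 x.2 hxy h0
    exact mem_iUnion.2 ⟨k, hx, hy, hk, hne, hxy⟩
  have diff {I J I' J' g g'} (b : InverseBranch θ I J g) (b' : InverseBranch θ I' J' g')
      (h : ∀ κ, ¬ BranchCoincidence F J J' g g' κ) (κ : ℝ) : {x : ℝ × ℝ | x.1 ∈ I ∧ x.2 ∈ I' ∧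
      θ x.2 = θ x.1 + κ ∧ x.1 ≠ x.2 ∧ F x.1 = F x.2}.Countable := by
    refine (count b b' (h κ)).mono ?_
    rintro x ⟨hx, hy, hxy, -, hF'⟩
    exact ⟨hx, hy, hxy, hF'⟩
  have n₁ := ((all_phases (same b₁ c₁₁)).union (all_phases (diff b₁ b₂ c₁₂))).union
    (all_phases (diff b₁ b₃ c₁₃))
  have n₂ := ((all_phases (diff b₂ b₁ c₂₁)).union (all_phases (same b₂ c₂₂))).union
    (all_phases (diff b₂ b₃ c₂₃))
  have n₃ := ((all_phases (diff b₃ b₁ c₃₁)).union (all_phases (diff b₃ b₂ c₃₂))).union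
    (all_phases (same b₃ c₃₃))
  have tri (t : ℝ) (htp : t ≠ p) (htq : t ≠ q) : t ∈ Iio p ∨ t ∈ Ioo p q ∨ t ∈ Ioi q := by
    rcases htp.lt_or_gt with h | h
    · exact .inl h
    · exact .inr (htq.lt_or_gt.imp (fun h' => ⟨h, h'⟩) id)
  refine ((hcrit.union hzero).union ((n₁.union n₂).union n₃)).mono ?_
  rintro ⟨x, y⟩ ⟨hne, hxy⟩
  dsimp only at hne hxy
  by_cases hc : (x = p ∨ x = q) ∨ (y = p ∨ y = q)
  · exact .inl (.inl ⟨hc, hxy⟩)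
  by_cases h0 : F x = 0
  · exact .inl (.inr ⟨.inl h0, hxy⟩)
  push Not at hc
  right
  rcases tri x hc.1.1 hc.1.2 with hx | hx | hx <;> rcases tri y hc.2.1 hc.2.2 with hy | hy | hy
  · exact .inl (.inl (.inl (.inl ⟨hx, hy, hne, hxy, h0⟩)))
  · exact .inl (.inl (.inl (.inr ⟨hx, hy, hne, hxy, h0⟩)))
  · exact .inl (.inl (.inr ⟨hx, hy, hne, hxy, h0⟩))
  · exact .inl (.inr (.inl (.inl ⟨hx, hy, hne, hxy, h0⟩)))
  · exact .inl (.inr (.inl (.inr ⟨hx, hy, hne, hxy, h0⟩)))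
  · exact .inl (.inr (.inr ⟨hx, hy, hne, hxy, h0⟩))
  · exact .inr (.inl (.inl ⟨hx, hy, hne, hxy, h0⟩))
  · exact .inr (.inl (.inr ⟨hx, hy, hne, hxy, h0⟩))
  · exact .inr (.inr ⟨hx, hy, hne, hxy, h0⟩)

/-! ### Euler–Maclaurin summation for the derivative of zeta -/

/-- The function `x ↦ x ^ (m - s) * (α * log x + β)`. -/
noncomputable def powLog (s : ℂ) (m : ℤ) (α β : ℂ) (x : ℝ) : ℂ :=
  Complex.exp (-s * (Real.log x : ℂ)) * (α * (Real.log x : ℂ) + β) * (x : ℂ) ^ m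

/-- The family is closed under differentiation, which reduces all derivatives of `log x * x ^ (-s)`
to a recursion on coefficients. -/
theorem hasDerivAt_powLog (s : ℂ) (m : ℤ) (α β : ℂ) {x : ℝ} (hx : 0 < x) :
    HasDerivAt (powLog s m α β) (powLog s (m - 1) ((m - s) * α) (α + (m - s) * β) x) x := by
  have hx' : (x : ℂ) ≠ 0 := by exact_mod_cast hx.ne'
  have hl : HasDerivAt (fun x : ℝ => (Real.log x : ℂ)) ((x⁻¹ : ℝ) : ℂ) x :=
    (Real.hasDerivAt_log hx.ne').ofReal_comp
  have hz : HasDerivAt (fun x : ℝ => (x : ℂ) ^ m) (m * (x : ℂ) ^ (m - 1)) x :=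
    (hasDerivAt_zpow m (x : ℂ) (.inl hx')).comp_ofReal
  have := (((hl.const_mul (-s)).cexp).mul ((hl.const_mul α).add_const β)).mul hz
  refine this.congr_deriv ?_
  simp only [powLog, Pi.mul_apply]
  rw [zpow_sub_one₀ hx', Complex.ofReal_inv]
  ring

theorem norm_powLog (s : ℂ) (m : ℤ) (α β : ℂ) {x : ℝ} (hx : 0 < x) :
    ‖powLog s m α β x‖ = Real.exp (-s.re * Real.log x) * ‖α * (Real.log x : ℂ) + β‖ * x ^ m := by
  simp only [powLog, norm_mul, norm_zpow, Complex.norm_real, Real.norm_of_nonneg hx.le,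
    Complex.norm_exp]
  simp

theorem tendsto_powLog (s : ℂ) (m : ℤ) (α β : ℂ) (h : m < s.re) :
    Tendsto (powLog s m α β) atTop (𝓝 0) := by
  have h1 : Tendsto (fun x : ℝ => x ^ (-(s.re - m)) * Real.log x) atTop (𝓝 0) := by
    have := (isLittleO_log_rpow_atTop (sub_pos.2 h)).tendsto_div_nhds_zero
    refine this.congr' ?_
    filter_upwards [eventually_gt_atTop 0] with x hx
    rw [Real.rpow_neg hx.le, div_eq_mul_inv, mul_comm]
  have h2 := tendsto_rpow_neg_atTop (sub_pos.2 h)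
  have h3 : Tendsto (fun x : ℝ => ‖α‖ * (x ^ (-(s.re - m)) * Real.log x) +
      ‖β‖ * x ^ (-(s.re - m))) atTop (𝓝 0) := by
    simpa using (h1.const_mul ‖α‖).add (h2.const_mul ‖β‖)
  refine squeeze_zero_norm' ?_ h3
  filter_upwards [eventually_ge_atTop 1] with x hx
  have hx0 : 0 < x := by linarith
  rw [norm_powLog s m α β hx0]
  have e : Real.exp (-s.re * Real.log x) * x ^ m = x ^ (-(s.re - m)) := by
    rw [Real.rpow_def_of_pos hx0, ← Real.rpow_intCast, Real.rpow_def_of_pos hx0, ← Real.exp_add]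
    congr 1
    ring
  have hle : ‖α * (Real.log x : ℂ) + β‖ ≤ ‖α‖ * Real.log x + ‖β‖ := by
    refine (norm_add_le _ _).trans ?_
    rw [norm_mul, Complex.norm_real, Real.norm_of_nonneg (Real.log_nonneg hx)]
  calc _ = x ^ (-(s.re - m)) * ‖α * (Real.log x : ℂ) + β‖ := by rw [← e]; ring
    _ ≤ x ^ (-(s.re - m)) * (‖α‖ * Real.log x + ‖β‖) := by gcongr
    _ = _ := by ring

/-- The Euler–Maclaurin approximation to `∑ n ≥ x, log n * n ^ (-s)`. -/
noncomputable def logTail (s : ℂ) (x : ℝ) : ℂ :=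
  powLog s 1 (1 / (s - 1)) (1 / (s - 1) ^ 2) x + powLog s 0 1 0 x / 2 - powLog s (-1) (-s) 1 x / 12

/-- The error of the approximation `logTail` in the `n`-th summand. -/
noncomputable def logTailError (s : ℂ) (n : ℕ) : ℂ :=
  powLog s 0 1 0 n - logTail s n + logTail s (n + 1)

/-- The leading coefficient of the fourth derivative of `log x * x ^ (-s)`. -/
noncomputable def fourthCoeff (s : ℂ) : ℂ := s * (s + 1) * (s + 2) * (s + 3)

/-- The derivative of `fourthCoeff`. -/
noncomputable def fourthCoeffDeriv (s : ℂ) : ℂ := (2 * s + 3) * (2 * s ^ 2 + 6 * s + 2)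

/-- Let f be `log x * x ^ (-s)` and K = u²(1 − u)² with u = x − n. Four integrations by parts turn
the integral of K f⁗ over [n, n + 1] into −24 times the error. As K ≤ 1/16, the constant is 24 · 16
= 384. -/
theorem norm_logTailError_le {s : ℂ} (hs : s ≠ 1) {n : ℕ} (hn : 0 < n) {G G' : ℝ → ℝ}
    (hG : ∀ x : ℝ, n ≤ x → HasDerivAt G (-G' x) x)
    (hle : ∀ x : ℝ, n ≤ x →
      ‖powLog s (-4) (fourthCoeff s) (-fourthCoeffDeriv s) x‖ ≤ G' x) :
    ‖logTailError s n‖ ≤ (G n - G (n + 1)) / 384 := by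
  have hs' : s - 1 ≠ 0 := sub_ne_zero.2 hs
  have hn' : (0 : ℝ) < n := by exact_mod_cast hn
  set K : ℝ → ℂ := fun x => ((x - n : ℝ) : ℂ) ^ 2 * (1 - ((x - n : ℝ) : ℂ)) ^ 2
  -- The primitive K f‴ − K′f″ + K″f′ − K‴f + 24∫f of K f⁗. At the ends K and K′ vanish, K″ = 2 and
  -- K‴ = ∓12.
  set H : ℝ → ℂ := fun x =>
    K x * powLog s (-3) (-(s * (s + 1) * (s + 2))) (3 * s ^ 2 + 6 * s + 2) x
    - (2 * ((x - n : ℝ) : ℂ) - 6 * ((x - n : ℝ) : ℂ) ^ 2 + 4 * ((x - n : ℝ) : ℂ) ^ 3)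
        * powLog s (-2) (s * (s + 1)) (-(2 * s + 1)) x
    + (2 - 12 * ((x - n : ℝ) : ℂ) + 12 * ((x - n : ℝ) : ℂ) ^ 2) * powLog s (-1) (-s) 1 x
    - (-12 + 24 * ((x - n : ℝ) : ℂ)) * powLog s 0 1 0 x
    - 24 * powLog s 1 (1 / (s - 1)) (1 / (s - 1) ^ 2) x with hH
  have hderiv : ∀ x : ℝ, n ≤ x →
      HasDerivAt H (K x * powLog s (-4) (fourthCoeff s) (-fourthCoeffDeriv s) x) x := by
    intro x hx
    have hx0 : 0 < x := hn'.trans_le hx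
    have hu : HasDerivAt (fun x : ℝ => ((x - n : ℝ) : ℂ)) 1 x := by
      simpa using ((hasDerivAt_id x).sub_const (n : ℝ)).ofReal_comp
    have d3 := hasDerivAt_powLog s (-3) (-(s * (s + 1) * (s + 2))) (3 * s ^ 2 + 6 * s + 2) hx0
    have d2 := hasDerivAt_powLog s (-2) (s * (s + 1)) (-(2 * s + 1)) hx0
    have d1 := hasDerivAt_powLog s (-1) (-s) 1 hx0
    have d0 := hasDerivAt_powLog s 0 1 0 hx0
    have dI := hasDerivAt_powLog s 1 (1 / (s - 1)) (1 / (s - 1) ^ 2) hx0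
    have k0 := (hu.pow 2).mul ((hu.const_sub 1).pow 2)
    have k1 := ((hu.const_mul 2).sub ((hu.pow 2).const_mul 6)).add ((hu.pow 3).const_mul 4)
    have k2 := ((hu.const_mul 12).const_sub 2).add ((hu.pow 2).const_mul 12)
    have k3 := (hu.const_mul 24).const_add (-12)
    have := ((((k0.mul d3).sub (k1.mul d2)).add (k2.mul d1)).sub (k3.mul d0)).sub (dI.const_mul 24)
    refine this.congr_deriv ?_
    have eI : powLog s (1 - 1) (((1 : ℤ) - s) * (1 / (s - 1)))
        (1 / (s - 1) + ((1 : ℤ) - s) * (1 / (s - 1) ^ 2)) x = - powLog s 0 1 0 x := by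
      have a : ((1 : ℤ) - s) * (1 / (s - 1)) = -1 := by field_simp; push_cast; ring
      have b : 1 / (s - 1) + ((1 : ℤ) - s) * (1 / (s - 1) ^ 2) = 0 := by
        field_simp; push_cast; ring
      rw [a, b]
      simp [powLog]
    have e0 : powLog s (0 - 1) (((0 : ℤ) - s) * 1) (1 + ((0 : ℤ) - s) * 0) x
        = powLog s (-1) (-s) 1 x := by simp
    have e1 : powLog s (-1 - 1) (((-1 : ℤ) - s) * -s) (-s + ((-1 : ℤ) - s) * 1) x
        = powLog s (-2) (s * (s + 1)) (-(2 * s + 1)) x := by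
      congr 1 <;> push_cast <;> ring
    have e2 : powLog s (-2 - 1) (((-2 : ℤ) - s) * (s * (s + 1)))
        (s * (s + 1) + ((-2 : ℤ) - s) * -(2 * s + 1)) x
        = powLog s (-3) (-(s * (s + 1) * (s + 2))) (3 * s ^ 2 + 6 * s + 2) x := by
      congr 1 <;> push_cast <;> ring
    have e3 : powLog s (-3 - 1) (((-3 : ℤ) - s) * -(s * (s + 1) * (s + 2)))
        (-(s * (s + 1) * (s + 2)) + ((-3 : ℤ) - s) * (3 * s ^ 2 + 6 * s + 2)) x
        = powLog s (-4) (fourthCoeff s) (-fourthCoeffDeriv s) x := by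
      unfold fourthCoeff fourthCoeffDeriv
      congr 1 <;> push_cast <;> ring
    rw [eI, e0, e1, e2, e3]
    simp only [K, Pi.mul_apply, Pi.pow_apply, Pi.sub_apply, Pi.add_apply, Nat.cast_ofNat]
    ring
  have hend : H (n + 1) - H n = -24 * logTailError s n := by
    simp only [hH, K, logTailError, logTail]
    push_cast
    simp only [sub_self, add_sub_cancel_left]
    ring
  have hB : ∀ x : ℝ, n ≤ x → HasDerivAt (fun x => (G n - G x) / 16) (G' x / 16) x := fun x hx => by
    simpa using ((hG x hx).const_sub (G n)).div_const 16
  have hbound : ‖H (n + 1) - H n‖ ≤ (G n - G (n + 1)) / 16 := by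
    refine image_norm_le_of_norm_deriv_right_le_deriv_boundary'
      (f := fun x => H x - H n) (f' := fun x => K x * powLog s (-4) (fourthCoeff s)
        (-fourthCoeffDeriv s) x) (a := (n : ℝ)) (b := n + 1)
      (B := fun x => (G n - G x) / 16) (B' := fun x => G' x / 16)
      (fun x hx => ((hderiv x hx.1).sub_const _).continuousAt.continuousWithinAt)
      (fun x hx => ((hderiv x hx.1).sub_const _).hasDerivWithinAt) (by simp)
      (fun x hx => (hB x hx.1).continuousAt.continuousWithinAt)
      (fun x hx => (hB x hx.1).hasDerivWithinAt) (fun x hx => ?_) (right_mem_Icc.2 (by linarith))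
    have hK : ‖K x‖ ≤ 1 / 16 := by
      obtain ⟨h0, h1⟩ := hx
      have : K x = (((x - n) * (1 - (x - n))) ^ 2 : ℝ) := by simp only [K]; push_cast; ring
      rw [this, Complex.norm_real, Real.norm_of_nonneg (sq_nonneg _)]
      have a0 : 0 ≤ (x - n) * (1 - (x - n)) := mul_nonneg (by linarith) (by linarith)
      have a1 : (x - n) * (1 - (x - n)) ≤ 1 / 4 := by nlinarith [sq_nonneg (x - n - 1 / 2)]
      nlinarith
    rw [norm_mul]
    have := mul_le_mul hK (hle x hx.1) (norm_nonneg _) (by norm_num)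
    linarith
  rw [hend] at hbound
  simp only [norm_mul, norm_neg, Complex.norm_ofNat] at hbound
  linarith

/-- A crude bound, uniform in `s`, meant only for convergence and holomorphy of the error series. -/
theorem norm_logTailError_le_of_norm_le {s : ℂ} {R : ℝ} (hs : s ≠ 1) (hre : 0 < s.re)
    (hR : ‖s‖ ≤ R) {n : ℕ} (hn : 0 < n) :
    ‖logTailError s n‖ ≤ (R + 3) ^ 4 * (1 / (n : ℝ) ^ 2) := by
  have hR0 : 0 ≤ R := (norm_nonneg s).trans hR
  have hn' : (1 : ℝ) ≤ n := by exact_mod_cast hn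
  have h1 : ‖fourthCoeff s‖ ≤ (R + 3) ^ 4 := by
    have a1 : ‖s + 1‖ ≤ R + 3 := (norm_add_le _ _).trans (by simp; linarith)
    have a2 : ‖s + 2‖ ≤ R + 3 := (norm_add_le _ _).trans (by simp; linarith)
    have a3 : ‖s + 3‖ ≤ R + 3 := (norm_add_le _ _).trans (by simp; linarith)
    have a0 : ‖s‖ ≤ R + 3 := by linarith
    simp only [fourthCoeff, norm_mul]
    calc _ ≤ (R + 3) * (R + 3) * (R + 3) * (R + 3) := by gcongr
      _ = _ := by ring
  have h2 : ‖fourthCoeffDeriv s‖ ≤ 4 * (R + 3) ^ 3 := by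
    have a1 : ‖2 * s + 3‖ ≤ 2 * R + 3 := (norm_add_le _ _).trans (by simp; linarith)
    have a2 : ‖2 * s ^ 2 + 6 * s + 2‖ ≤ 2 * R ^ 2 + 6 * R + 2 := by
      refine (norm_add₃_le).trans ?_
      simp only [norm_mul, norm_pow, Complex.norm_ofNat]
      gcongr
    simp only [fourthCoeffDeriv, norm_mul]
    calc _ ≤ (2 * R + 3) * (2 * R ^ 2 + 6 * R + 2) := by gcongr
      _ ≤ _ := by nlinarith [pow_nonneg hR0 3, pow_nonneg hR0 2]
  have h3 : ‖fourthCoeffDeriv s‖ ≤ 2 * (R + 3) ^ 4 := by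
    nlinarith [pow_nonneg (by linarith : 0 ≤ R + 3) 3, pow_nonneg (by linarith : 0 ≤ R + 3) 4]
  set C := (R + 3) ^ 4
  have hC : 0 ≤ C := by positivity
  clear_value C
  have key := norm_logTailError_le hs hn (G := fun x => C * (x ^ 2)⁻¹)
    (G' := fun x => C * (2 * x) / x ^ 4) ?_ ?_
  · refine key.trans ?_
    have : 0 ≤ C * (((n : ℝ) + 1) ^ 2)⁻¹ := by positivity
    have : 0 ≤ C * (1 / (n : ℝ) ^ 2) := by positivity
    simp only [one_div] at *
    linarith
  · intro x hx
    have hx0 : x ≠ 0 := by linarith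
    refine (((hasDerivAt_pow 2 x).inv (by positivity)).const_mul C).congr_deriv ?_
    field_simp
    norm_num
    ring
  · intro x hx
    have hx1 : 1 ≤ x := hn'.trans hx
    have hx0 : 0 < x := by linarith
    rw [norm_powLog _ _ _ _ hx0]
    have hl0 := Real.log_nonneg hx1
    have hl1 := Real.log_le_sub_one_of_pos hx0
    have e1 : Real.exp (-s.re * Real.log x) ≤ 1 := Real.exp_le_one_iff.2 (by nlinarith)
    have e2 : ‖fourthCoeff s * (Real.log x : ℂ) + -fourthCoeffDeriv s‖ ≤ C * (2 * x) := by
      refine (norm_add_le _ _).trans ?_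
      rw [norm_mul, norm_neg, Complex.norm_real, Real.norm_of_nonneg hl0]
      have : ‖fourthCoeff s‖ * Real.log x ≤ C * (x - 1) := by gcongr
      nlinarith
    have e3 : x ^ (-4 : ℤ) = 1 / x ^ 4 := by
      rw [zpow_neg, one_div]; norm_cast
    rw [e3, mul_one_div]
    refine div_le_div_of_nonneg_right ?_ (by positivity)
    calc _ ≤ 1 * (C * (2 * x)) := mul_le_mul e1 e2 (norm_nonneg _) zero_le_one
      _ = _ := one_mul _

/-- A convex bounded domain that meets both the critical line and the half-plane of absolute
convergence. -/
def upperBox : Set ℂ := {s : ℂ | 0 < s.re ∧ 1 < s.im} ∩ Metric.ball 0 10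

theorem isOpen_upperBox : IsOpen upperBox :=
  ((isOpen_lt continuous_const Complex.continuous_re).inter
    (isOpen_lt continuous_const Complex.continuous_im)).inter Metric.isOpen_ball

theorem convex_upperBox : Convex ℝ upperBox :=
  ((convex_halfSpace_re_gt 0).inter (convex_halfSpace_im_gt 1)).inter (convex_ball _ _)

theorem ne_one_of_mem_upperBox {s : ℂ} (hs : s ∈ upperBox) : s ≠ 1 := by
  rintro rfl
  have := hs.1.2
  norm_num at this

theorem summable_tail_bound : Summable fun n : ℕ => ((10 : ℝ) + 3) ^ 4 * (1 / ((n + 2 : ℕ) : ℝ) ^ 2) :=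
  ((summable_nat_add_iff 2).2 (Real.summable_one_div_nat_pow.2 one_lt_two)).mul_left _

theorem norm_logTailError_le_of_mem_upperBox (n : ℕ) {s : ℂ} (hs : s ∈ upperBox) :
    ‖logTailError s (n + 2 : ℕ)‖ ≤ ((10 : ℝ) + 3) ^ 4 * (1 / ((n + 2 : ℕ) : ℝ) ^ 2) :=
  norm_logTailError_le_of_norm_le (ne_one_of_mem_upperBox hs) hs.1.1
    (by simpa using (Metric.mem_ball.1 hs.2).le) (by omega)

theorem differentiableAt_powLog {m : ℤ} {α β : ℂ → ℂ} {s : ℂ} (hα : DifferentiableAt ℂ α s)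
    (hβ : DifferentiableAt ℂ β s) (x : ℝ) :
    DifferentiableAt ℂ (fun s => powLog s m (α s) (β s) x) s := by
  unfold powLog
  fun_prop

theorem differentiableAt_logTail {s : ℂ} (hs : s ≠ 1) (x : ℝ) :
    DifferentiableAt ℂ (fun s => logTail s x) s := by
  have h : s - 1 ≠ 0 := sub_ne_zero.2 hs
  have h2 : (s - 1) ^ 2 ≠ 0 := pow_ne_zero 2 h
  unfold logTail
  refine ((differentiableAt_powLog ?_ ?_ x).add
    ((differentiableAt_powLog ?_ ?_ x).div_const 2)).sub
    ((differentiableAt_powLog ?_ ?_ x).div_const 12)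
  · exact (differentiableAt_const _).div (by fun_prop) h
  · exact (differentiableAt_const _).div (by fun_prop) h2
  all_goals fun_prop

theorem differentiableAt_logTailError {s : ℂ} (hs : s ≠ 1) (n : ℕ) :
    DifferentiableAt ℂ (fun s => logTailError s n) s := by
  unfold logTailError
  exact ((differentiableAt_powLog (by fun_prop) (by fun_prop) _).sub
    (differentiableAt_logTail hs _)).add (differentiableAt_logTail hs _)

/-- The Dirichlet series of −ζ′ converges here; `logTail` telescopes in its partial sums and tends
to zero. -/
theorem deriv_riemannZeta_eq_of_one_lt_re {s : ℂ} (hs : s ∈ upperBox) (hre : 1 < s.re) :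
    deriv riemannZeta s = -(logTail s 2 + ∑' n : ℕ, logTailError s (n + 2 : ℕ)) := by
  have hab : LSeries.abscissaOfAbsConv 1 < s.re := by
    rw [LSeries.abscissaOfAbsConv_one]; exact_mod_cast hre
  have hev : LSeries 1 =ᶠ[𝓝 s] riemannZeta := by
    filter_upwards [(isOpen_lt continuous_const Complex.continuous_re).mem_nhds hre] with z hz
    exact LSeries_one_eq_riemannZeta hz
  rw [← hev.deriv_eq, LSeries_deriv hab, neg_inj]
  have hsum := LSeriesSummable_logMul_of_lt_re hab
  have hterm (n : ℕ) : LSeries.term (LSeries.logMul 1) s n = powLog s 0 1 0 n := by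
    rcases eq_or_ne n 0 with rfl | hn
    · simp [powLog]
    · rw [LSeries.term_of_ne_zero hn]
      simp only [LSeries.logMul, Pi.one_apply, mul_one, powLog, zpow_zero, one_mul, add_zero]
      rw [Complex.cpow_def_of_ne_zero (by exact_mod_cast hn), div_eq_mul_inv, ← Complex.exp_neg,
        ← Complex.natCast_log]
      ring_nf
  have hT : Tendsto (fun N : ℕ => ∑ n ∈ Finset.range N, powLog s 0 1 0 n) atTop
      (𝓝 (LSeries (LSeries.logMul 1) s)) := by
    exact hsum.hasSum.tendsto_sum_nat.congr fun N => Finset.sum_congr rfl fun n _ => hterm n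
  have hE : Tendsto (fun N : ℕ => ∑ n ∈ Finset.range N, logTailError s (n + 2 : ℕ)) atTop
      (𝓝 (∑' n : ℕ, logTailError s (n + 2 : ℕ))) :=
    (summable_tail_bound.of_norm_bounded fun n =>
      norm_logTailError_le_of_mem_upperBox n hs).hasSum.tendsto_sum_nat
  have hA : Tendsto (fun x : ℝ => logTail s x) atTop (𝓝 0) := by
    unfold logTail
    have t1 := tendsto_powLog s 1 (1 / (s - 1)) (1 / (s - 1) ^ 2) (by simpa using hre)
    have t2 := tendsto_powLog s 0 1 0 (by push_cast; linarith)
    have t3 := tendsto_powLog s (-1) (-s) 1 (by push_cast; linarith)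
    simpa using (t1.add (t2.div_const 2)).sub (t3.div_const 12)
  -- The terms 0 and 1 vanish, the former through `Real.log 0 = 0`, so the tail starts at 2.
  have hfin (N : ℕ) : ∑ n ∈ Finset.range (N + 2), powLog s 0 1 0 n =
      (∑ n ∈ Finset.range N, logTailError s (n + 2 : ℕ)) + logTail s 2 - logTail s (N + 2 : ℕ) := by
    induction N with
    | zero => simp [Finset.sum_range_succ, powLog]
    | succ N ih =>
      rw [show N + 1 + 2 = (N + 2) + 1 by ring, Finset.sum_range_succ, ih, Finset.sum_range_succ]
      simp only [logTailError]
      push_cast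
      ring
  have hlim := (hE.add_const (logTail s 2)).sub
    (hA.comp (tendsto_natCast_atTop_atTop.comp (tendsto_add_atTop_nat 2)))
  have := tendsto_nhds_unique ((hT.comp (tendsto_add_atTop_nat 2)).congr hfin) hlim
  rw [this]
  ring

/-- Both sides are holomorphic on the convex box and agree near 2 + 2i, so the identity theorem
carries the formula to the critical line. -/
theorem deriv_riemannZeta_eq {s : ℂ} (hs : s ∈ upperBox) :
    deriv riemannZeta s = -(logTail s 2 + ∑' n : ℕ, logTailError s (n + 2 : ℕ)) := by
  have h1 : DifferentiableOn ℂ (deriv riemannZeta) upperBox :=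
    DifferentiableOn.deriv (fun z hz =>
      (differentiableAt_riemannZeta (ne_one_of_mem_upperBox hz)).differentiableWithinAt)
      isOpen_upperBox
  have h2 : DifferentiableOn ℂ (fun s => -(logTail s 2 + ∑' n : ℕ, logTailError s (n + 2 : ℕ)))
      upperBox := by
    refine (DifferentiableOn.add (fun z hz =>
      (differentiableAt_logTail (ne_one_of_mem_upperBox hz) 2).differentiableWithinAt) ?_).neg
    exact Complex.differentiableOn_tsum_of_summable_norm summable_tail_bound
      (fun n z hz => (differentiableAt_logTailError (ne_one_of_mem_upperBox hz)
        _).differentiableWithinAt) isOpen_upperBox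
      fun n w hw => norm_logTailError_le_of_mem_upperBox n hw
  have hmem : (⟨2, 2⟩ : ℂ) ∈ upperBox := by
    refine ⟨⟨by norm_num, by norm_num⟩, ?_⟩
    rw [mem_ball_zero_iff]
    refine (Complex.norm_le_abs_re_add_abs_im _).trans_lt ?_
    norm_num
  refine (h1.analyticOnNhd isOpen_upperBox).eqOn_of_preconnected_of_eventuallyEq
    (h2.analyticOnNhd isOpen_upperBox) convex_upperBox.isPreconnected hmem ?_ hs
  filter_upwards [isOpen_upperBox.mem_nhds hmem,
    (isOpen_lt continuous_const Complex.continuous_re).mem_nhds (show (1 : ℝ) < (⟨2, 2⟩ : ℂ).re by norm_num)]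
    with z hz hz'
  exact deriv_riemannZeta_eq_of_one_lt_re hz hz'

/-! ### Numerical nonvanishing of the derivative of zeta -/

theorem norm_fourthCoeff_le {t : ℝ} (h0 : 0 ≤ t) (h1 : t ≤ 6.4) : ‖fourthCoeff ⟨1 / 2, t⟩‖ ≤ 2120 := by
  have ht2 : t ^ 2 ≤ 40.96 := by nlinarith
  have e : ∀ a : ℝ, Complex.normSq ⟨a, t⟩ = a ^ 2 + t ^ 2 := fun a => by
    rw [Complex.normSq_mk]; ring
  have e0 : (⟨1 / 2, t⟩ : ℂ) + 1 = ⟨3 / 2, t⟩ := by apply Complex.ext <;> norm_num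
  have e1 : (⟨1 / 2, t⟩ : ℂ) + 2 = ⟨5 / 2, t⟩ := by apply Complex.ext <;> norm_num
  have e2 : (⟨1 / 2, t⟩ : ℂ) + 3 = ⟨7 / 2, t⟩ := by apply Complex.ext <;> norm_num
  refine (sq_le_sq₀ (norm_nonneg _) (by norm_num)).1 ?_
  rw [← Complex.normSq_eq_norm_sq, fourthCoeff, map_mul, map_mul, map_mul, e0, e1, e2, e, e, e, e]
  calc _ ≤ ((1 / 2 : ℝ) ^ 2 + 40.96) * ((3 / 2) ^ 2 + 40.96) * ((5 / 2) ^ 2 + 40.96) *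
      ((7 / 2) ^ 2 + 40.96) := by gcongr
    _ ≤ _ := by norm_num

/-- This is the coefficient of the fourth derivative at x = 2. Real and imaginary parts are bounded
after combining the two summands, since the triangle inequality would lose too much. -/
theorem norm_fourthCoeff_mul_log_two_sub_le {t : ℝ} (h0 : 5.8 ≤ t) (h1 : t ≤ 6.4) :
    ‖fourthCoeff ⟨1 / 2, t⟩ * (Real.log 2 : ℂ) - fourthCoeffDeriv ⟨1 / 2, t⟩‖ ≤ 1640 := by
  have hL0 := Real.log_two_gt_d9
  have hL1 := Real.log_two_lt_d9
  set l := Real.log 2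
  have hz : fourthCoeff ⟨1 / 2, t⟩ * (l : ℂ) - fourthCoeffDeriv ⟨1 / 2, t⟩ =
      ⟨l * (t ^ 4 - 43 / 2 * t ^ 2 + 105 / 16) + 24 * t ^ 2 - 22,
        -((8 * l - 4) * t ^ 3 + (43 - 22 * l) * t)⟩ := by
    unfold fourthCoeff fourthCoeffDeriv
    apply Complex.ext <;> simp [pow_two] <;> ring
  have ht2 : t ^ 2 ≤ 40.96 := by nlinarith
  have ht2' : 33.64 ≤ t ^ 2 := by nlinarith
  have ht3 : t ^ 3 ≤ 262.144 := by
    calc t ^ 3 ≤ (6.4 : ℝ) ^ 3 := by gcongr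
      _ = _ := by norm_num
  have q1 : t ^ 4 - 43 / 2 * t ^ 2 + 105 / 16 ≤ 803.7 := by nlinarith
  have q0 : 0 ≤ t ^ 4 - 43 / 2 * t ^ 2 + 105 / 16 := by nlinarith
  have re1 : l * (t ^ 4 - 43 / 2 * t ^ 2 + 105 / 16) + 24 * t ^ 2 - 22 ≤ 1520 := by
    nlinarith
  have re0 : 0 ≤ l * (t ^ 4 - 43 / 2 * t ^ 2 + 105 / 16) + 24 * t ^ 2 - 22 := by
    nlinarith
  have im1 : (8 * l - 4) * t ^ 3 + (43 - 22 * l) * t ≤ 585 := by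
    have a1 : (8 * l - 4) * t ^ 3 ≤ 1.546 * 262.144 :=
      mul_le_mul (by linarith) ht3 (by positivity) (by norm_num)
    have a2 : (43 - 22 * l) * t ≤ 27.76 * 6.4 :=
      mul_le_mul (by linarith) h1 (by linarith) (by norm_num)
    linarith
  have im0 : 0 ≤ (8 * l - 4) * t ^ 3 + (43 - 22 * l) * t :=
    add_nonneg (mul_nonneg (by linarith) (by positivity)) (mul_nonneg (by linarith) (by linarith))
  refine (sq_le_sq₀ (norm_nonneg _) (by norm_num)).1 ?_
  rw [hz, ← Complex.normSq_eq_norm_sq, Complex.normSq_mk]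
  nlinarith

theorem logTail_two (s : ℂ) : logTail s 2 = Complex.exp (-s * (Real.log 2 : ℂ)) *
    (2 * (1 / (s - 1) * Real.log 2 + (1 / (s - 1)) ^ 2) + Real.log 2 / 2
      - (1 - s * Real.log 2) / 24) := by
  simp only [logTail, powLog, zpow_one, zpow_zero, zpow_neg, one_div, inv_pow]
  push_cast
  ring

/-- The exponential factor has modulus 2^(−1/2), and the real part of the other factor already
exceeds 0.238. The inverse square `r` of |s − 1| is at most 1/33.89, where 33.89 = 5.8² + 1/4. -/
theorem lt_norm_logTail_two {t : ℝ} (h0 : 5.8 ≤ t) :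
    Real.exp (-(1 / 2) * Real.log 2) * 0.238 < ‖logTail ⟨1 / 2, t⟩ 2‖ := by
  have hL0 := Real.log_two_gt_d9
  rw [logTail_two, norm_mul, Complex.norm_exp]
  have e : (-(⟨1 / 2, t⟩ : ℂ) * (Real.log 2 : ℂ)).re = -(1 / 2) * Real.log 2 := by
    rw [Complex.mul_re]
    simp only [Complex.neg_re, Complex.ofReal_re, Complex.ofReal_im]
    ring
  rw [e]
  refine mul_lt_mul_of_pos_left ?_ (Real.exp_pos _)
  refine lt_of_lt_of_le ?_ (Complex.re_le_norm _)
  set l := Real.log 2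
  set r : ℝ := (1 / 4 + t ^ 2)⁻¹ with hr
  have hr1 : r * (1 / 4 + t ^ 2) = 1 := inv_mul_cancel₀ (by positivity)
  have hr0 : 0 < r := by positivity
  have hr2 : r ≤ 1 / 33.89 := by
    rw [le_div_iff₀ (by norm_num)]
    nlinarith
  have hinv : 1 / ((⟨1 / 2, t⟩ : ℂ) - 1) = ⟨-(1 / 2) * r, -t * r⟩ := by
    refine (eq_one_div_of_mul_eq_one_left ?_).symm
    apply Complex.ext
    · simp; linarith
    · simp; ring
  rw [hinv]
  have hre : (2 * ((⟨-(1 / 2) * r, -t * r⟩ : ℂ) * l + (⟨-(1 / 2) * r, -t * r⟩ : ℂ) ^ 2) + l / 2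
      - (1 - (⟨1 / 2, t⟩ : ℂ) * l) / 24).re
      = l * (25 / 48 - r) - 2 * r * (r * (1 / 4 + t ^ 2)) + r ^ 2 - 1 / 24 := by
    simp [pow_two]
    ring
  rw [hre, hr1]
  nlinarith

/-- The derivative of the zeta function has no zeros on this segment of the critical line. -/
theorem deriv_riemannZeta_ne_zero {t : ℝ} (h0 : 5.8 ≤ t) (h1 : t ≤ 6.4) :
    deriv riemannZeta ⟨1 / 2, t⟩ ≠ 0 := by
  set s : ℂ := ⟨1 / 2, t⟩ with hs_def
  have hs : s ∈ upperBox := by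
    refine ⟨⟨by norm_num [hs_def], by simp only [hs_def]; linarith⟩, ?_⟩
    rw [mem_ball_zero_iff]
    refine (Complex.norm_le_abs_re_add_abs_im _).trans_lt ?_
    simp only [hs_def]
    rw [abs_of_nonneg (by linarith : 0 ≤ t)]
    norm_num
    linarith
  set l := Real.log 2
  -- The integral of `G'` from `x` to infinity; `G'` decays like x^(−9/2) log x, whence the divisor
  -- 3.5.
  set G : ℝ → ℝ := fun x => Real.exp (-(1 / 2) * Real.log x) *
    (2120 / 3.5 * Real.log x + ((1640 - 2120 * l) / 3.5 + 2120 / 3.5 ^ 2)) * (x ^ 3)⁻¹ with hG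
  set G' : ℝ → ℝ := fun x => Real.exp (-(1 / 2) * Real.log x) *
    (1640 + 2120 * (Real.log x - l)) * (x ^ 4)⁻¹ with hG'
  have hderiv (x : ℝ) (hx : 2 ≤ x) : HasDerivAt G (-G' x) x := by
    have hx0 : x ≠ 0 := by linarith
    have hl := Real.hasDerivAt_log hx0
    have := (((hl.const_mul (-(1 / 2))).exp).mul ((hl.const_mul (2120 / 3.5)).add_const
      ((1640 - 2120 * l) / 3.5 + 2120 / 3.5 ^ 2))).mul ((hasDerivAt_pow 3 x).inv (by positivity))
    refine this.congr_deriv ?_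
    simp only [hG', Pi.mul_apply, Pi.inv_apply]
    field_simp
    norm_num
    ring
  have hbound (x : ℝ) (hx : 2 ≤ x) :
      ‖powLog s (-4) (fourthCoeff s) (-fourthCoeffDeriv s) x‖ ≤ G' x := by
    have hx0 : 0 < x := by linarith
    have hlx : l ≤ Real.log x := Real.log_le_log (by norm_num) hx
    rw [norm_powLog _ _ _ _ hx0, zpow_neg]
    have hn : ‖fourthCoeff s * (Real.log x : ℂ) + -fourthCoeffDeriv s‖
        ≤ 1640 + 2120 * (Real.log x - l) := by
      have : fourthCoeff s * (Real.log x : ℂ) + -fourthCoeffDeriv s =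
          (fourthCoeff s * (l : ℂ) - fourthCoeffDeriv s) +
            fourthCoeff s * ((Real.log x - l : ℝ) : ℂ) := by push_cast; ring
      rw [this]
      refine (norm_add_le _ _).trans ?_
      rw [norm_mul, Complex.norm_real, Real.norm_of_nonneg (sub_nonneg.2 hlx)]
      have a1 := norm_fourthCoeff_mul_log_two_sub_le h0 h1
      have a2 := norm_fourthCoeff_le (by linarith : 0 ≤ t) h1
      have a3 := mul_le_mul_of_nonneg_right a2 (sub_nonneg.2 hlx)
      linarith
    have hre : s.re = 1 / 2 := rfl
    rw [hre]
    simp only [hG']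
    norm_cast
    gcongr
  have hterm (n : ℕ) : ‖logTailError s (n + 2 : ℕ)‖ ≤ (G (n + 2 : ℕ) - G ((n + 1 : ℕ) + 2 : ℕ)) / 384 := by
    have := norm_logTailError_le (ne_one_of_mem_upperBox hs) (n := n + 2) (by omega) (G := G)
      (G' := G') (fun x hx => hderiv x ?_) (fun x hx => hbound x ?_)
    · refine this.trans (le_of_eq ?_)
      push_cast
      ring_nf
    all_goals
      push_cast at hx
      have : (0 : ℝ) ≤ n := n.cast_nonneg
      linarith
  have hGpos (x : ℝ) (hx : 2 ≤ x) : 0 ≤ G x := by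
    have hlx : l ≤ Real.log x := Real.log_le_log (by norm_num) hx
    have : 0 ≤ 2120 / 3.5 * Real.log x + ((1640 - 2120 * l) / 3.5 + 2120 / 3.5 ^ 2) := by
      norm_num
      linarith
    simp only [hG]
    positivity
  have hsum : ‖∑' n : ℕ, logTailError s (n + 2 : ℕ)‖ ≤ G 2 / 384 := by
    have hE := (summable_tail_bound.of_norm_bounded fun n =>
      norm_logTailError_le_of_mem_upperBox n hs).hasSum.tendsto_sum_nat
    refine le_of_tendsto hE.norm (Eventually.of_forall fun N => ?_)
    calc _ ≤ ∑ n ∈ Finset.range N, ‖logTailError s (n + 2 : ℕ)‖ := norm_sum_le _ _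
      _ ≤ ∑ n ∈ Finset.range N, (G (n + 2 : ℕ) - G ((n + 1 : ℕ) + 2 : ℕ)) / 384 :=
        Finset.sum_le_sum fun n _ => hterm n
      _ = (G 2 - G (N + 2 : ℕ)) / 384 := by
        rw [← Finset.sum_div, Finset.sum_range_sub' (fun n : ℕ => G (n + 2 : ℕ))]
        norm_num
      _ ≤ _ := by
        have := hGpos (N + 2 : ℕ) (by push_cast; linarith [(N.cast_nonneg : (0 : ℝ) ≤ N)])
        linarith
  -- At 2 the logarithms cancel, and the remaining constant is about 0.209.
  have hG2 : G 2 / 384 ≤ Real.exp (-(1 / 2) * l) * 0.238 := by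
    have : G 2 / 384 = Real.exp (-(1 / 2) * l) * ((1640 / 3.5 + 2120 / 3.5 ^ 2) / 8 / 384) := by
      simp only [hG]
      ring
    rw [this]
    gcongr
    norm_num
  have hA := lt_norm_logTail_two h0
  rw [deriv_riemannZeta_eq hs]
  intro h
  have : logTail s 2 = -∑' n : ℕ, logTailError s (n + 2 : ℕ) := by
    linear_combination -h
  rw [← hs_def, this, norm_neg] at hA
  linarith

/-! ### The slope of the phase and its critical point -/

/-- The derivative of `phaseTerm`, up to a factor `1 / 2`; here `y` is half the argument. -/
noncomputable def phaseSlope (j : ℕ) (y : ℝ) : ℝ :=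
  Real.log ((j + 2) / (j + 1)) - (j + 1 / 4) / ((j + 1 / 4) ^ 2 + y ^ 2)

/-- Both parts of the slope are 1/(j + 1) up to a quadratically small error. -/
theorem abs_phaseSlope_le (j : ℕ) (y : ℝ) :
    |phaseSlope j y| ≤ (4 + 16 * y ^ 2) * (1 / ((j + 1 : ℕ) : ℝ) ^ 2) := by
  have hj : (0 : ℝ) ≤ j := j.cast_nonneg
  unfold phaseSlope
  push_cast
  generalize hx : (j : ℝ) + 1 = x
  have hx1 : 1 ≤ x := by linarith
  have e1 : (j : ℝ) + 2 = x + 1 := by linarith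
  generalize hb : (j : ℝ) + 1 / 4 = b
  have e2 : b = x - 3 / 4 := by linarith
  rw [e1]
  have hx0 : 0 < x := by linarith
  have hb0 : x / 4 ≤ b := by linarith
  have hbp : 0 < b := by linarith
  have l1 : Real.log ((x + 1) / x) ≤ 1 / x := by
    refine (Real.log_le_sub_one_of_pos (by positivity)).trans (le_of_eq ?_)
    field_simp
    ring
  have l0 : 1 / x - 1 / x ^ 2 ≤ Real.log ((x + 1) / x) := by
    have := Real.one_sub_inv_le_log_of_pos (show 0 < (x + 1) / x by positivity)
    refine le_trans ?_ this
    rw [inv_div, ← sub_nonneg]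
    have : 1 - x / (x + 1) - (1 / x - 1 / x ^ 2) = 1 / (x ^ 2 * (x + 1)) := by field_simp; ring
    rw [this]
    positivity
  have hq : 0 < b ^ 2 + y ^ 2 := by positivity
  have hxq : x ^ 2 / 16 ≤ b ^ 2 + y ^ 2 := by nlinarith [sq_nonneg y]
  obtain ⟨q, hqe⟩ : ∃ q, q = b ^ 2 + y ^ 2 := ⟨_, rfl⟩
  have hq' : q ≠ 0 := by rw [hqe]; exact hq.ne'
  have d1 : 1 / x - b / (b ^ 2 + y ^ 2) ≤ 16 * y ^ 2 * (1 / x ^ 2) := by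
    rw [← sub_nonneg]
    have : 16 * y ^ 2 * (1 / x ^ 2) - (1 / x - b / (b ^ 2 + y ^ 2)) =
        (y ^ 2 * (16 * (b ^ 2 + y ^ 2) - x) + 3 / 4 * b * x) / (x ^ 2 * (b ^ 2 + y ^ 2)) := by
      have hy : y ^ 2 = q - b ^ 2 := by linarith
      rw [← hqe, hy, e2]
      field_simp
      ring
    rw [this]
    have : x ≤ 16 * (b ^ 2 + y ^ 2) := by nlinarith
    have : 0 ≤ y ^ 2 * (16 * (b ^ 2 + y ^ 2) - x) := mul_nonneg (sq_nonneg y) (by linarith)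
    positivity
  have d0 : b / (b ^ 2 + y ^ 2) - 1 / x ≤ 3 * (1 / x ^ 2) := by
    rw [← sub_nonneg]
    have : 3 * (1 / x ^ 2) - (b / (b ^ 2 + y ^ 2) - 1 / x) =
        (3 * (b ^ 2 + y ^ 2) + x * y ^ 2 - 3 / 4 * b * x) / (x ^ 2 * (b ^ 2 + y ^ 2)) := by
      have hy : y ^ 2 = q - b ^ 2 := by linarith
      rw [← hqe, hy, e2]
      field_simp
      ring
    rw [this]
    have : 0 ≤ 3 * (b ^ 2 + y ^ 2) + x * y ^ 2 - 3 / 4 * b * x := by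
      nlinarith [sq_nonneg y, mul_nonneg hx0.le (sq_nonneg y)]
    positivity
  have hp : 0 ≤ 1 / x ^ 2 := by positivity
  have hyp : 0 ≤ 16 * y ^ 2 * (1 / x ^ 2) := by positivity
  rw [abs_le]
  constructor <;> nlinarith

theorem summable_phaseSlope_bound (C : ℝ) :
    Summable fun j : ℕ => C * (1 / ((j + 1 : ℕ) : ℝ) ^ 2) :=
  ((summable_nat_add_iff 1).2 (Real.summable_one_div_nat_pow.2 one_lt_two)).mul_left _

theorem summable_phaseSlope (y : ℝ) : Summable fun j => phaseSlope j y :=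
  (summable_phaseSlope_bound _).of_norm_bounded fun j => abs_phaseSlope_le j y

theorem tsum_phaseSlope_strictMono {x y : ℝ} (hx : 0 ≤ x) (hxy : x < y) :
    ∑' j, phaseSlope j x < ∑' j, phaseSlope j y := by
  have hlt (j : ℕ) : phaseSlope j x < phaseSlope j y := by
    unfold phaseSlope
    gcongr
  exact (summable_phaseSlope x).tsum_lt_tsum (i := 0) (fun j => (hlt j).le) (hlt 0)
    (summable_phaseSlope y)

/-- The middle quantity is artanh(b/m). Its power series is bounded below by the first term and
above by a geometric series. -/
theorem half_log_div_bounds {m b : ℝ} (hb : 0 ≤ b) (hbm : b < m) :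
    b / m ≤ (Real.log (m + b) - Real.log (m - b)) / 2 ∧
      (Real.log (m + b) - Real.log (m - b)) / 2 ≤ b * m / (m ^ 2 - b ^ 2) := by
  have hm : 0 < m := by linarith
  set x := b / m
  have hx0 : 0 ≤ x := by positivity
  have hx1 : x < 1 := (div_lt_one hm).2 hbm
  have hs := Real.hasSum_log_sub_log_of_abs_lt_one (abs_lt.2 ⟨by linarith, hx1⟩)
  have e1 : m + b = m * (1 + x) := by simp only [x]; field_simp
  have e2 : m - b = m * (1 - x) := by simp only [x]; field_simp
  rw [e1, e2, Real.log_mul hm.ne' (by linarith), Real.log_mul hm.ne' (by linarith)]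
  constructor
  · have := le_hasSum hs 0 fun k _ => by positivity
    norm_num at this
    linarith
  · have hx2 : x ^ 2 < 1 := by nlinarith
    have hg := (hasSum_geometric_of_lt_one (sq_nonneg x) hx2).mul_left (2 * x)
    have hle := hasSum_le (fun k => ?_) hs hg
    · have : b * m / (m ^ 2 - b ^ 2) = x * (1 - x ^ 2)⁻¹ := by
        have : m ^ 2 - b ^ 2 ≠ 0 := by nlinarith
        have : 1 - x ^ 2 ≠ 0 := by linarith
        simp only [x] at *
        field_simp
      rw [this]
      linarith
    · have : (1 : ℝ) / (2 * k + 1) ≤ 1 := by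
        rw [div_le_one (by positivity)]
        linarith [(k.cast_nonneg : (0 : ℝ) ≤ k)]
      calc 2 * (1 / (2 * k + 1)) * x ^ (2 * k + 1) ≤ 2 * 1 * x ^ (2 * k + 1) := by gcongr
        _ = _ := by ring

/-- A telescoping approximation to the sums of `phaseSlope`. -/
noncomputable def slopeApprox (y : ℝ) (j : ℕ) : ℝ :=
  Real.log (j + 1) - Real.log ((j - 1 / 4) ^ 2 + y ^ 2) / 2

theorem tendsto_slopeApprox {y : ℝ} (hy : 0 < y) : Tendsto (slopeApprox y) atTop (𝓝 0) := by
  have hu : Tendsto (fun j : ℕ => (1 : ℝ) / ((j : ℝ) + 1)) atTop (𝓝 0) :=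
    tendsto_one_div_add_atTop_nhds_zero_nat
  have h1 : Tendsto (fun j : ℕ => (1 - 5 / 4 * (1 / ((j : ℝ) + 1))) ^ 2 +
      (y * (1 / ((j : ℝ) + 1))) ^ 2) atTop (𝓝 1) := by
    simpa using (((hu.const_mul (5 / 4 : ℝ)).const_sub 1).pow 2).add
      ((hu.const_mul y).pow 2)
  have h2 := ((Real.continuousAt_log one_ne_zero).tendsto.comp h1).const_mul (-(1 / 2 : ℝ))
  simp only [Real.log_one, mul_zero] at h2
  refine h2.congr fun j => ?_
  have hj : (0 : ℝ) < (j : ℝ) + 1 := by positivity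
  have hq : 0 < ((j : ℝ) - 1 / 4) ^ 2 + y ^ 2 := by positivity
  have : (1 - 5 / 4 * (1 / ((j : ℝ) + 1))) ^ 2 + (y * (1 / ((j : ℝ) + 1))) ^ 2 =
      (((j : ℝ) - 1 / 4) ^ 2 + y ^ 2) / ((j : ℝ) + 1) ^ 2 := by
    field_simp
    ring
  simp only [Function.comp_apply, slopeApprox, this]
  rw [Real.log_div hq.ne' (by positivity), Real.log_pow]
  push_cast
  ring

/-- Midpoint rule for u/(u² + y²) on [j − 1/4, j + 3/4]: the integral is a difference of logarithms,
and the error is bounded by a telescoping difference. -/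
theorem phaseSlope_bounds {y : ℝ} (hy : 2 ≤ y) (j : ℕ) :
    slopeApprox y (j + 1) - slopeApprox y j - 1 / 7 * (1 / ((j - 1 / 4) ^ 2 + y ^ 2) -
        1 / (((j + 1 : ℕ) - 1 / 4) ^ 2 + y ^ 2)) ≤ phaseSlope j y ∧
      phaseSlope j y ≤ slopeApprox y (j + 1) - slopeApprox y j +
        3 / 8 * (1 / ((j - 1 / 4) ^ 2 + y ^ 2) - 1 / (((j + 1 : ℕ) - 1 / 4) ^ 2 + y ^ 2)) := by
  have hj : (0 : ℝ) ≤ j := j.cast_nonneg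
  simp only [slopeApprox, phaseSlope]
  push_cast
  rw [Real.log_div (by positivity) (by positivity), show (j : ℝ) + 1 + 1 = j + 2 by ring]
  generalize hb : (j : ℝ) + 1 / 4 = b
  have hb0 : 0 < b := by linarith
  set m := b ^ 2 + y ^ 2 + 1 / 4 with hm
  have hm2 : 2 ≤ m := by nlinarith
  have hbm : b < m := by nlinarith [sq_nonneg (b - 1 / 2)]
  have e1 : ((j : ℝ) - 1 / 4) ^ 2 + y ^ 2 = m - b := by rw [hm, ← hb]; ring
  have e2 : ((j : ℝ) + 1 - 1 / 4) ^ 2 + y ^ 2 = m + b := by rw [hm, ← hb]; ring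
  have e3 : b ^ 2 + y ^ 2 = m - 1 / 4 := by rw [hm]; ring
  rw [e1, e2, e3]
  obtain ⟨h0, h1⟩ := half_log_div_bounds hb0.le hbm
  have p1 : 0 < m - b := by linarith
  have p2 : 0 < m + b := by linarith
  have p3 : 0 < m - 1 / 4 := by linarith
  have hmb : m ^ 2 - b ^ 2 = (m - b) * (m + b) := by ring
  have hdiff : 1 / (m - b) - 1 / (m + b) = 2 * b / (m ^ 2 - b ^ 2) := by
    rw [hmb]; field_simp; ring
  have hp : 0 < m ^ 2 - b ^ 2 := by rw [hmb]; positivity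
  have hbsq : b ^ 2 ≤ m - 3 / 16 := by nlinarith
  rw [hdiff]
  have k0 : b / (m - 1 / 4) - b / m ≤ 1 / 7 * (2 * b / (m ^ 2 - b ^ 2)) := by
    rw [← sub_nonneg]
    have : 1 / 7 * (2 * b / (m ^ 2 - b ^ 2)) - (b / (m - 1 / 4) - b / m) =
        b * (2 * m * (m - 1 / 4) / 7 - (m ^ 2 - b ^ 2) / 4) / (m * (m - 1 / 4) * (m ^ 2 - b ^ 2)) := by
      have := hp.ne'
      have : m * 4 - 1 ≠ 0 := by linarith
      have : 4 * m - 1 ≠ 0 := by linarith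
      field_simp
      ring
    rw [this]
    have : 0 ≤ 2 * m * (m - 1 / 4) / 7 - (m ^ 2 - b ^ 2) / 4 := by nlinarith
    positivity
  have k1 : b * m / (m ^ 2 - b ^ 2) - b / (m - 1 / 4) ≤ 3 / 8 * (2 * b / (m ^ 2 - b ^ 2)) := by
    rw [← sub_nonneg]
    have : 3 / 8 * (2 * b / (m ^ 2 - b ^ 2)) - (b * m / (m ^ 2 - b ^ 2) - b / (m - 1 / 4)) =
        b * (m - 3 / 16 - b ^ 2) / ((m - 1 / 4) * (m ^ 2 - b ^ 2)) := by
      have := hp.ne'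
      have : m * 4 - 1 ≠ 0 := by linarith
      have : 4 * m - 1 ≠ 0 := by linarith
      field_simp
      ring
    rw [this]
    have : 0 ≤ m - 3 / 16 - b ^ 2 := by linarith
    positivity
  constructor <;> linarith

theorem tsum_phaseSlope_bounds {y : ℝ} (hy : 2 ≤ y) :
    Real.log (1 / 16 + y ^ 2) / 2 - 1 / 7 * (1 / (1 / 16 + y ^ 2)) ≤ ∑' j, phaseSlope j y ∧
      ∑' j, phaseSlope j y ≤ Real.log (1 / 16 + y ^ 2) / 2 + 3 / 8 * (1 / (1 / 16 + y ^ 2)) := by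
  have hlim := (summable_phaseSlope y).hasSum.tendsto_sum_nat
  have hT := tendsto_slopeApprox (by linarith : 0 < y)
  set r : ℕ → ℝ := fun j => 1 / (((j : ℕ) - 1 / 4) ^ 2 + y ^ 2) with hr
  have hr0 (j : ℕ) : 0 ≤ r j := by simp only [hr]; positivity
  have h0 : slopeApprox y 0 = -(Real.log (1 / 16 + y ^ 2) / 2) := by
    simp only [slopeApprox]; norm_num
  have hr00 : r 0 = 1 / (1 / 16 + y ^ 2) := by simp only [hr]; norm_num
  rw [← hr00]
  constructor
  · have h1 := hT.sub_const (slopeApprox y 0 + 1 / 7 * r 0)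
    rw [zero_sub, h0, neg_add, neg_neg, ← sub_eq_add_neg] at h1
    refine le_of_tendsto_of_tendsto' h1 hlim fun N => ?_
    have := Finset.sum_le_sum fun j (_ : j ∈ Finset.range N) => (phaseSlope_bounds hy j).1
    rw [Finset.sum_sub_distrib, Finset.sum_range_sub, ← Finset.mul_sum,
      Finset.sum_range_sub' r] at this
    have := hr0 N
    linarith
  · have h1 := hT.sub_const (slopeApprox y 0 - 3 / 8 * r 0)
    rw [zero_sub, h0, neg_sub, sub_neg_eq_add, add_comm (3 / 8 * r 0)] at h1
    refine le_of_tendsto_of_tendsto' hlim h1 fun N => ?_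
    have := Finset.sum_le_sum fun j (_ : j ∈ Finset.range N) => (phaseSlope_bounds hy j).2
    rw [Finset.sum_add_distrib, Finset.sum_range_sub, ← Finset.mul_sum,
      Finset.sum_range_sub' r] at this
    have := hr0 N
    linarith

/-- The sum is close to log y, so it crosses log π near y = π; 2.9 and 3.2 lie on either side. -/
theorem tsum_phaseSlope_lt_log_pi : ∑' j, phaseSlope j 2.9 < Real.log Real.pi := by
  refine (tsum_phaseSlope_bounds (by norm_num)).2.trans_lt ?_
  have hpi := Real.pi_gt_d2
  have hz : (9.8596 : ℝ) ≤ Real.pi ^ 2 := by nlinarith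
  have h := Real.one_sub_inv_le_log_of_pos (show 0 < Real.pi ^ 2 / (1 / 16 + 2.9 ^ 2) by positivity)
  rw [Real.log_div (by positivity) (by norm_num), Real.log_pow, inv_div] at h
  have : (1 / 16 + 2.9 ^ 2) / Real.pi ^ 2 ≤ (0.86 : ℝ) := by
    rw [div_le_iff₀ (by positivity)]
    norm_num
    linarith
  push_cast at h
  norm_num at h this ⊢
  linarith

theorem log_pi_lt_tsum_phaseSlope : Real.log Real.pi < ∑' j, phaseSlope j 3.2 := by
  refine lt_of_lt_of_le ?_ (tsum_phaseSlope_bounds (by norm_num)).1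
  have hpi := Real.pi_lt_d2
  have hpi0 := Real.pi_pos
  have hz : Real.pi ^ 2 ≤ (9.9225 : ℝ) := by nlinarith
  have h := Real.one_sub_inv_le_log_of_pos (show 0 < (1 / 16 + 3.2 ^ 2) / Real.pi ^ 2 by positivity)
  rw [Real.log_div (by norm_num) (by positivity), Real.log_pow, inv_div] at h
  have : Real.pi ^ 2 / (1 / 16 + 3.2 ^ 2) ≤ (0.9632 : ℝ) := by
    rw [div_le_iff₀ (by positivity)]
    norm_num
    linarith
  push_cast at h
  norm_num at h this ⊢
  linarith

/-! ### Phases of complex numbers -/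

/-- `z` is a nonzero complex number with argument `φ` modulo `2 * π`. -/
def HasPhase (z : ℂ) (φ : ℝ) : Prop := ∃ c : ℝ, 0 < c ∧ z = c * Complex.exp (φ * Complex.I)

namespace HasPhase

theorem mul {z w : ℂ} {φ ψ : ℝ} (hz : HasPhase z φ) (hw : HasPhase w ψ) :
    HasPhase (z * w) (φ + ψ) := by
  obtain ⟨c, hc, rfl⟩ := hz
  obtain ⟨d, hd, rfl⟩ := hw
  refine ⟨c * d, by positivity, ?_⟩
  push_cast
  rw [add_mul, Complex.exp_add]
  ring

theorem inv {z : ℂ} {φ : ℝ} (hz : HasPhase z φ) : HasPhase z⁻¹ (-φ) := by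
  obtain ⟨c, hc, rfl⟩ := hz
  refine ⟨c⁻¹, by positivity, ?_⟩
  rw [mul_inv, ← Complex.exp_neg]
  push_cast
  ring_nf

theorem div {z w : ℂ} {φ ψ : ℝ} (hz : HasPhase z φ) (hw : HasPhase w ψ) :
    HasPhase (z / w) (φ - ψ) := by
  simpa [div_eq_mul_inv, sub_eq_add_neg] using hz.mul hw.inv

theorem of_pos {c : ℝ} (hc : 0 < c) : HasPhase (c : ℂ) 0 := ⟨c, hc, by simp⟩

theorem prod {ι : Type*} (s : Finset ι) {z : ι → ℂ} {φ : ι → ℝ} (h : ∀ i, HasPhase (z i) (φ i)) :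
    HasPhase (∏ i ∈ s, z i) (∑ i ∈ s, φ i) := by
  classical
  induction s using Finset.induction_on with
  | empty => simpa using of_pos one_pos
  | insert a s ha ih => rw [Finset.prod_insert ha, Finset.sum_insert ha]; exact (h a).mul ih

theorem mk_arctan {b y : ℝ} (hb : 0 < b) : HasPhase (b + y * Complex.I) (Real.arctan (y / b)) := by
  have hr : 0 < √(1 + (y / b) ^ 2) := by positivity
  refine ⟨b * √(1 + (y / b) ^ 2), by positivity, ?_⟩
  rw [Complex.exp_mul_I, ← Complex.ofReal_cos, ← Complex.ofReal_sin, Real.cos_arctan,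
    Real.sin_arctan]
  apply Complex.ext
  · simp only [Complex.add_re, Complex.ofReal_re, Complex.mul_re, Complex.ofReal_im, Complex.I_re,
      Complex.I_im, Complex.add_im, Complex.mul_im]
    field_simp
    ring
  · simp only [Complex.add_re, Complex.ofReal_re, Complex.mul_re, Complex.ofReal_im, Complex.I_re,
      Complex.I_im, Complex.add_im, Complex.mul_im]
    field_simp
    ring

theorem cpow {x : ℝ} (hx : 0 < x) (a y : ℝ) :
    HasPhase ((x : ℂ) ^ (a + y * Complex.I)) (y * Real.log x) := by
  refine ⟨Real.exp (Real.log x * a), Real.exp_pos _, ?_⟩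
  rw [Complex.cpow_def_of_ne_zero (by exact_mod_cast hx.ne'), ← Complex.ofReal_log hx.le,
    Complex.ofReal_exp, ← Complex.exp_add]
  congr 1
  push_cast
  ring

/-- After rotation by the phases the sequence is positive, so its limit is a nonnegative real, and
it is nonzero. -/
theorem of_tendsto {z : ℕ → ℂ} {φ : ℕ → ℝ} {w : ℂ} {ψ : ℝ} (h : ∀ᶠ n in atTop, HasPhase (z n) (φ n))
    (hz : Tendsto z atTop (𝓝 w)) (hφ : Tendsto φ atTop (𝓝 ψ)) (hw : w ≠ 0) : HasPhase w ψ := by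
  have hlim : Tendsto (fun n => z n * Complex.exp (-(φ n * Complex.I))) atTop
      (𝓝 (w * Complex.exp (-(ψ * Complex.I)))) := by
    refine hz.mul ((Complex.continuous_exp.tendsto _).comp ?_)
    exact (((Complex.continuous_ofReal.tendsto ψ).comp hφ).mul_const _).neg
  set v := w * Complex.exp (-(ψ * Complex.I)) with hv
  have hreal : ∀ᶠ n in atTop, 0 ≤ (z n * Complex.exp (-(φ n * Complex.I))).re ∧
      (z n * Complex.exp (-(φ n * Complex.I))).im = 0 := by
    filter_upwards [h] with n hn
    obtain ⟨c, hc, hn⟩ := hn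
    rw [hn, mul_assoc, ← Complex.exp_add, add_neg_cancel, Complex.exp_zero, mul_one]
    exact ⟨hc.le, Complex.ofReal_im c⟩
  have hre : 0 ≤ v.re := ge_of_tendsto ((Complex.continuous_re.tendsto v).comp hlim)
    (hreal.mono fun n hn => hn.1)
  have him : v.im = 0 := tendsto_nhds_unique_of_eventuallyEq
    ((Complex.continuous_im.tendsto v).comp hlim) tendsto_const_nhds (hreal.mono fun n hn => hn.2)
  have hv0 : v ≠ 0 := mul_ne_zero hw (Complex.exp_ne_zero _)
  have hvr : v = (v.re : ℂ) := Complex.ext rfl (by simpa using him)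
  refine ⟨v.re, lt_of_le_of_ne hre fun h0 => hv0 ?_, ?_⟩
  · rw [hvr, ← h0, Complex.ofReal_zero]
  · rw [← hvr, hv, mul_assoc, ← Complex.exp_add, neg_add_cancel, Complex.exp_zero, mul_one]

theorem arg_eq {z : ℂ} {φ : ℝ} (h : HasPhase z φ) (hφ : φ ∈ Ioc (-Real.pi) Real.pi) :
    z.arg = φ := by
  obtain ⟨c, hc, rfl⟩ := h
  rw [Complex.exp_mul_I]
  exact Complex.arg_mul_cos_add_sin_mul_I hc hφ

/-- Multiplying a nonzero number by numbers of phases `φ` and `ψ` gives two real results only if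
`φ` and `ψ` agree modulo `π`. -/
theorem eq_add_int_mul_pi {z w u : ℂ} {φ ψ : ℝ} (hz : HasPhase z φ) (hw : HasPhase w ψ) (hu : u ≠ 0)
    (hzu : (z * u).im = 0) (hwu : (w * u).im = 0) : ∃ k : ℤ, ψ = φ + k * Real.pi := by
  have hz0 : z ≠ 0 := by
    obtain ⟨c, hc, rfl⟩ := hz
    exact mul_ne_zero (by exact_mod_cast hc.ne') (Complex.exp_ne_zero _)
  have him : (w / z).im = 0 := by
    have : w / z = (w * u) / (z * u) := by field_simp
    rw [this, Complex.div_im, hzu, hwu]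
    simp
  obtain ⟨c, hc, h⟩ := hw.div hz
  rw [h, Complex.im_ofReal_mul, Complex.exp_ofReal_mul_I_im] at him
  obtain ⟨k, hk⟩ := Real.sin_eq_zero_iff.1 ((mul_eq_zero.1 him).resolve_left hc.ne')
  exact ⟨k, by linarith⟩

end HasPhase

/-! ### The Riemann–Siegel theta function -/

/-- The summands of the series for the argument of `Gamma (1 / 4 + t / 2 * I)`. -/
noncomputable def phaseTerm (j : ℕ) (t : ℝ) : ℝ :=
  t / 2 * Real.log ((j + 2) / (j + 1)) - Real.arctan (t / 2 / (j + 1 / 4))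

/-- The Riemann–Siegel theta function, a continuous argument of `Gammaℝ` on the critical line. -/
noncomputable def riemannSiegelTheta (t : ℝ) : ℝ := ∑' j, phaseTerm j t - t / 2 * Real.log Real.pi

theorem hasDerivAt_phaseTerm (j : ℕ) (t : ℝ) :
    HasDerivAt (phaseTerm j) (phaseSlope j (t / 2) / 2) t := by
  have hb : (0 : ℝ) < j + 1 / 4 := by positivity
  have h2 : HasDerivAt (fun t : ℝ => t / 2) (1 / 2) t := (hasDerivAt_id t).div_const 2
  refine ((h2.mul_const _).sub (h2.div_const _).arctan).congr_deriv ?_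
  unfold phaseSlope
  have : ((j : ℝ) + 1 / 4) ^ 2 + (t / 2) ^ 2 ≠ 0 := by positivity
  have : 1 + (t / 2 / ((j : ℝ) + 1 / 4)) ^ 2 ≠ 0 := by positivity
  generalize (j : ℝ) + 1 / 4 = b at *
  field_simp

/-- The derivatives are dominated by a summable series on bounded intervals, and all terms vanish at
0. -/
theorem summable_phaseTerm_and_hasDerivAt (t : ℝ) : Summable (fun j => phaseTerm j t) ∧
    HasDerivAt (fun t => ∑' j, phaseTerm j t) (∑' j, phaseSlope j (t / 2) / 2) t := by
  set R := |t| + 1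
  have ht : t ∈ Ioo (-R) R := by
    constructor <;> simp only [R] <;> linarith [neg_abs_le t, le_abs_self t]
  have h0 : (0 : ℝ) ∈ Ioo (-R) R := by
    constructor <;> simp only [R] <;> linarith [abs_nonneg t]
  have hb (j : ℕ) (y : ℝ) (hy : y ∈ Ioo (-R) R) : ‖phaseSlope j (y / 2) / 2‖ ≤
      (4 + 4 * R ^ 2) * (1 / ((j + 1 : ℕ) : ℝ) ^ 2) := by
    have := abs_phaseSlope_le j (y / 2)
    have hyR : y ^ 2 ≤ R ^ 2 := sq_le_sq' hy.1.le hy.2.le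
    have h1 : (4 + 16 * (y / 2) ^ 2) * (1 / ((j + 1 : ℕ) : ℝ) ^ 2) ≤
        (4 + 4 * R ^ 2) * (1 / ((j + 1 : ℕ) : ℝ) ^ 2) := by
      gcongr ?_ * _
      linarith
    rw [norm_div, Real.norm_eq_abs, Real.norm_two]
    linarith [abs_nonneg (phaseSlope j (y / 2))]
  have hs0 : Summable fun j => phaseTerm j 0 := by simp [phaseTerm]
  exact ⟨summable_of_summable_hasDerivAt_of_isPreconnected (summable_phaseSlope_bound _) isOpen_Ioo
    isPreconnected_Ioo (fun j y _ => hasDerivAt_phaseTerm j y) hb h0 hs0 ht,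
    hasDerivAt_tsum_of_isPreconnected (summable_phaseSlope_bound _) isOpen_Ioo isPreconnected_Ioo
    (fun j y _ => hasDerivAt_phaseTerm j y) hb h0 hs0 ht⟩

theorem hasDerivAt_riemannSiegelTheta (t : ℝ) : HasDerivAt riemannSiegelTheta
    ((∑' j, phaseSlope j (t / 2) - Real.log Real.pi) / 2) t := by
  have h2 : HasDerivAt (fun t : ℝ => t / 2 * Real.log Real.pi) (1 / 2 * Real.log Real.pi) t :=
    ((hasDerivAt_id t).div_const 2).mul_const _
  refine ((summable_phaseTerm_and_hasDerivAt t).2.sub h2).congr_deriv ?_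
  rw [tsum_div_const]
  ring

theorem riemannSiegelTheta_neg (t : ℝ) : riemannSiegelTheta (-t) = -riemannSiegelTheta t := by
  have (j : ℕ) : phaseTerm j (-t) = -phaseTerm j t := by
    simp only [phaseTerm, neg_div, Real.arctan_neg]
    ring
  simp only [riemannSiegelTheta, this, tsum_neg]
  ring

/-- Each factor of Euler's product n^s n!/∏(s + j) has an explicit phase; the limit is taken with
`HasPhase.of_tendsto`. -/
theorem hasPhase_Gamma (t : ℝ) :
    HasPhase (Complex.Gamma ((1 / 4 : ℝ) + (t / 2 : ℝ) * Complex.I)) (∑' j, phaseTerm j t) := by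
  set s : ℂ := (1 / 4 : ℝ) + (t / 2 : ℝ) * Complex.I
  have hs : 0 < s.re := by simp [s]
  refine HasPhase.of_tendsto (φ := fun n => t / 2 * Real.log n - ∑ j ∈ Finset.range (n + 1),
    Real.arctan (t / 2 / (j + 1 / 4))) ?_ (Complex.GammaSeq_tendsto_Gamma s) ?_
    (Complex.Gamma_ne_zero_of_re_pos hs)
  · filter_upwards [eventually_gt_atTop 0] with n hn
    have h1 := HasPhase.cpow (x := n) (by exact_mod_cast hn) (1 / 4) (t / 2)
    have h2 := HasPhase.of_pos (c := (n.factorial : ℝ)) (by positivity)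
    have h3 := HasPhase.prod (Finset.range (n + 1)) fun j : ℕ =>
      HasPhase.mk_arctan (b := j + 1 / 4) (y := t / 2) (by positivity)
    have := (h1.mul h2).div h3
    rw [add_zero] at this
    have e : ∏ j ∈ Finset.range (n + 1), (((j + 1 / 4 : ℝ) : ℂ) + (t / 2 : ℝ) * Complex.I) =
        ∏ j ∈ Finset.range (n + 1), (s + j) := Finset.prod_congr rfl fun j _ => by
      simp only [s]
      push_cast
      ring
    rw [e] at this
    simpa only [Complex.GammaSeq, Complex.ofReal_natCast] using this
  · have h1 := (summable_phaseTerm_and_hasDerivAt t).1.hasSum.tendsto_sum_nat.comp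
      (tendsto_add_atTop_nat 1)
    -- The logarithms in the first n + 1 terms telescope to log(n + 2), whereas Euler's product has
    -- log n.
    have h2 : Tendsto (fun n : ℕ => Real.log ((n + 2) / n)) atTop (𝓝 0) := by
      have : Tendsto (fun n : ℕ => 1 + 2 / (n : ℝ)) atTop (𝓝 1) := by
        simpa using (tendsto_const_div_atTop_nhds_zero_nat (2 : ℝ)).const_add 1
      have := (Real.continuousAt_log one_ne_zero).tendsto.comp this
      rw [Real.log_one] at this
      refine this.congr' ?_
      filter_upwards [eventually_gt_atTop 0] with n hn
      have : (n : ℝ) ≠ 0 := by exact_mod_cast hn.ne'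
      simp only [Function.comp_apply]
      congr 1
      field_simp
    have h3 := h1.sub (h2.const_mul (t / 2))
    rw [mul_zero, sub_zero] at h3
    refine h3.congr' ?_
    filter_upwards [eventually_gt_atTop 0] with n hn
    have hn' : (n : ℝ) ≠ 0 := by exact_mod_cast hn.ne'
    have hsum (N : ℕ) : ∑ j ∈ Finset.range N, Real.log (((j : ℝ) + 2) / (j + 1)) =
        Real.log (N + 1) := by
      induction N with
      | zero => simp
      | succ N ih =>
        rw [Finset.sum_range_succ, ih, Real.log_div (by positivity) (by positivity)]
        push_cast
        rw [show (N : ℝ) + 1 + 1 = N + 2 by ring]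
        ring
    simp only [Function.comp_apply, phaseTerm, Finset.sum_sub_distrib, ← Finset.mul_sum, hsum]
    rw [Real.log_div (by positivity) hn']
    push_cast
    rw [show (n : ℝ) + 1 + 1 = n + 2 by ring]
    ring

/-! ### Gamma factor, theta and zeta on the critical line -/

/-- The parametrization of the critical line by its ordinate. -/
noncomputable def lineMap (t : ℝ) : ℂ := 1 / 2 + Complex.I * t

theorem lineMap_re (t : ℝ) : (lineMap t).re = 1 / 2 := by simp [lineMap]

theorem lineMap_im (t : ℝ) : (lineMap t).im = t := by simp [lineMap]

theorem lineMap_eq_mk (t : ℝ) : lineMap t = ⟨1 / 2, t⟩ :=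
  Complex.ext (lineMap_re t) (lineMap_im t)

theorem lineMap_ne_zero (t : ℝ) : lineMap t ≠ 0 := fun h => by
  have := lineMap_re t
  rw [h] at this
  norm_num at this

theorem lineMap_ne_one (t : ℝ) : lineMap t ≠ 1 := fun h => by
  have := lineMap_re t
  rw [h] at this
  norm_num at this

theorem star_lineMap (t : ℝ) : star (lineMap t) = lineMap (-t) := by
  apply Complex.ext <;> simp [lineMap]

theorem one_sub_lineMap (t : ℝ) : 1 - lineMap t = lineMap (-t) := by
  simp only [lineMap]
  push_cast
  ring

theorem hasDerivAt_lineMap (t : ℝ) : HasDerivAt lineMap Complex.I t := by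
  exact (((Complex.ofRealCLM.hasDerivAt (x := t)).const_mul Complex.I).const_add (1 / 2)).congr_deriv
    (by simp)

theorem analyticAt_lineMap (t : ℝ) : AnalyticAt ℝ lineMap t := by
  unfold lineMap
  have := Complex.ofRealCLM.analyticAt t
  exact analyticAt_const.add (analyticAt_const.mul this)

theorem hasPhase_Gammaℝ (t : ℝ) : HasPhase (Complex.Gammaℝ (lineMap t)) (riemannSiegelTheta t) := by
  have h1 := HasPhase.cpow Real.pi_pos (-1 / 4) (-(t / 2))
  have := h1.mul (hasPhase_Gamma t)
  rw [Complex.Gammaℝ_def]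
  convert! this using 1
  · congr 2
    all_goals
      simp only [lineMap]
      push_cast
      ring
  · unfold riemannSiegelTheta
    ring

theorem analyticAt_Gammaℝ_lineMap (t : ℝ) : AnalyticAt ℝ (fun t => Complex.Gammaℝ (lineMap t)) t := by
  have h0 : Complex.Gammaℝ (lineMap t) ≠ 0 :=
    Complex.Gammaℝ_ne_zero_of_re_pos (by rw [lineMap_re]; norm_num)
  have h1 : AnalyticAt ℂ (fun s => (Complex.Gammaℝ s)⁻¹) (lineMap t) :=
    Complex.differentiable_Gammaℝ_inv.analyticAt _
  have h2 : AnalyticAt ℂ Complex.Gammaℝ (lineMap t) := by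
    simpa [Pi.inv_def] using h1.fun_inv (inv_ne_zero h0)
  exact h2.restrictScalars.fun_comp (analyticAt_lineMap t)

/-- Near `t` the increment of theta is less than π in size, so it is the principal argument of a
quotient of values of `Gammaℝ`. -/
theorem analyticAt_riemannSiegelTheta (t : ℝ) : AnalyticAt ℝ riemannSiegelTheta t := by
  have h0 : Complex.Gammaℝ (lineMap t) ≠ 0 :=
    Complex.Gammaℝ_ne_zero_of_re_pos (by rw [lineMap_re]; norm_num)
  have hq : AnalyticAt ℝ (fun u => Complex.Gammaℝ (lineMap u) / Complex.Gammaℝ (lineMap t)) t :=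
    (analyticAt_Gammaℝ_lineMap t).div analyticAt_const h0
  have hlog : AnalyticAt ℝ (fun u => Complex.log
      (Complex.Gammaℝ (lineMap u) / Complex.Gammaℝ (lineMap t))) t := by
    refine AnalyticAt.fun_comp (g := Complex.log) ?_ hq
    rw [div_self h0]
    exact (analyticAt_clog Complex.one_mem_slitPlane).restrictScalars
  have him := ((Complex.imCLM.analyticAt _).fun_comp hlog).add
    (analyticAt_const (v := riemannSiegelTheta t))
  refine him.congr ?_
  have hcont := (hasDerivAt_riemannSiegelTheta t).continuousAt
  filter_upwards [Metric.continuousAt_iff'.1 hcont Real.pi Real.pi_pos] with u hu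
  rw [Real.dist_eq, abs_lt] at hu
  have := ((hasPhase_Gammaℝ u).div (hasPhase_Gammaℝ t)).arg_eq ⟨hu.1, hu.2.le⟩
  simp only [Pi.add_apply, Complex.imCLM_apply, Complex.log_im, this]
  ring

theorem Gammaℝ_star (t : ℝ) :
    star (Complex.Gammaℝ (lineMap t)) = Complex.Gammaℝ (lineMap (-t)) := by
  rw [Complex.Gammaℝ_def, Complex.Gammaℝ_def, ← star_lineMap]
  have hpi : (Real.pi : ℂ).arg ≠ Real.pi := by
    rw [Complex.arg_ofReal_of_nonneg Real.pi_pos.le]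
    exact Real.pi_pos.ne
  have h1 := Complex.cpow_conj (Real.pi : ℂ) (-lineMap t / 2) hpi
  have h2 := Complex.Gamma_conj (lineMap t / 2)
  simp only [map_div₀, map_neg, Complex.conj_ofReal, map_ofNat] at h1 h2
  simp only [Complex.star_def, map_mul] at *
  rw [h1, h2]

/-- The product is the completed zeta function. Conjugation maps s to 1 − s on the critical line,
and the functional equation undoes this. -/
theorem im_Gammaℝ_mul_riemannZeta (t : ℝ) :
    (Complex.Gammaℝ (lineMap t) * riemannZeta (lineMap t)).im = 0 := by
  have hΛ (u : ℝ) : Complex.Gammaℝ (lineMap u) * riemannZeta (lineMap u) =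
      completedRiemannZeta (lineMap u) := by
    rw [riemannZeta_def_of_ne_zero (lineMap_ne_zero u)]
    exact mul_div_cancel₀ _ (Complex.Gammaℝ_ne_zero_of_re_pos (by rw [lineMap_re]; norm_num))
  have hz := riemannZeta_conj (lineMap t)
  rw [← Complex.conj_eq_iff_im, map_mul]
  have h1 := Gammaℝ_star t
  have h2 := star_lineMap t
  rw [Complex.star_def] at h1 h2
  rw [h1, ← hz, h2, hΛ, hΛ, ← one_sub_lineMap, completedRiemannZeta_one_sub]

theorem deriv_riemannSiegelTheta (t : ℝ) : deriv riemannSiegelTheta t =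
    (∑' j, phaseSlope j (t / 2) - Real.log Real.pi) / 2 :=
  (hasDerivAt_riemannSiegelTheta t).deriv

theorem deriv_riemannSiegelTheta_neg (t : ℝ) :
    deriv riemannSiegelTheta (-t) = deriv riemannSiegelTheta t := by
  simp only [deriv_riemannSiegelTheta, phaseSlope, neg_div, neg_sq]

theorem deriv_riemannSiegelTheta_lt {x y : ℝ} (hx : 0 ≤ x) (hxy : x < y) :
    deriv riemannSiegelTheta x < deriv riemannSiegelTheta y := by
  rw [deriv_riemannSiegelTheta, deriv_riemannSiegelTheta]
  have := tsum_phaseSlope_strictMono (by linarith : 0 ≤ x / 2) (by linarith : x / 2 < y / 2)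
  linarith

theorem exists_deriv_riemannSiegelTheta_eq_zero :
    ∃ τ ∈ Ioo (5.8 : ℝ) 6.4, deriv riemannSiegelTheta τ = 0 := by
  have hcont : Continuous (deriv riemannSiegelTheta) := continuous_iff_continuousAt.2 fun t =>
    (analyticAt_riemannSiegelTheta t).deriv.continuousAt
  refine intermediate_value_Ioo (by norm_num) hcont.continuousOn ⟨?_, ?_⟩
  · rw [deriv_riemannSiegelTheta, show (5.8 : ℝ) / 2 = 2.9 by norm_num]
    linarith [tsum_phaseSlope_lt_log_pi]
  · rw [deriv_riemannSiegelTheta, show (6.4 : ℝ) / 2 = 3.2 by norm_num]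
    linarith [log_pi_lt_tsum_phaseSlope]

/-- The slope increases on [0, ∞) and vanishes at `τ`, so beyond `τ + 1` it is at least a positive
constant. -/
theorem tendsto_riemannSiegelTheta_atTop : Tendsto riemannSiegelTheta atTop atTop := by
  obtain ⟨τ, ⟨hτ, -⟩, hτ0⟩ := exists_deriv_riemannSiegelTheta_eq_zero
  have hdiff : Differentiable ℝ riemannSiegelTheta := fun t =>
    (hasDerivAt_riemannSiegelTheta t).differentiableAt
  set c := deriv riemannSiegelTheta (τ + 1) with hc
  have hcpos : 0 < c := hτ0 ▸ deriv_riemannSiegelTheta_lt (by linarith) (by linarith)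
  have hlow (t : ℝ) (ht : τ + 1 ≤ t) :
      c * (t - (τ + 1)) + riemannSiegelTheta (τ + 1) ≤ riemannSiegelTheta t := by
    have := (convex_Ici (τ + 1)).mul_sub_le_image_sub_of_le_deriv hdiff.continuous.continuousOn
      hdiff.differentiableOn (C := c) (fun x hx => by
        rw [interior_Ici] at hx
        exact (deriv_riemannSiegelTheta_lt (by linarith) hx).le) (τ + 1) self_mem_Ici t ht ht
    linarith
  refine tendsto_atTop_mono' atTop (eventually_ge_atTop (τ + 1) |>.mono hlow) ?_
  exact tendsto_atTop_add_const_right _ _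
    ((tendsto_atTop_add_const_right _ _ tendsto_id).const_mul_atTop hcpos)

theorem tendsto_riemannSiegelTheta_atBot : Tendsto riemannSiegelTheta atBot atBot := by
  have := tendsto_neg_atTop_atBot.comp (tendsto_riemannSiegelTheta_atTop.comp tendsto_neg_atBot_atTop)
  refine this.congr fun t => ?_
  simp [riemannSiegelTheta_neg]

theorem hasDerivAt_riemannZeta_lineMap (t : ℝ) : HasDerivAt (fun t => riemannZeta (lineMap t))
    (Complex.I * deriv riemannZeta (lineMap t)) t := by
  have := HasDerivAt.scomp t (differentiableAt_riemannZeta (lineMap_ne_one t)).hasDerivAt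
    (hasDerivAt_lineMap t)
  simpa [Function.comp_def] using! this

theorem analyticAt_riemannZeta_lineMap (t : ℝ) :
    AnalyticAt ℝ (fun t => riemannZeta (lineMap t)) t := by
  have h : AnalyticAt ℂ riemannZeta (lineMap t) :=
    DifferentiableOn.analyticAt (s := {1}ᶜ)
      (fun z hz => (differentiableAt_riemannZeta hz).differentiableWithinAt)
      (isOpen_compl_singleton.mem_nhds (lineMap_ne_one t))
  exact h.restrictScalars.fun_comp (analyticAt_lineMap t)

theorem deriv_riemannZeta_lineMap_ne_zero {t : ℝ} (h0 : 5.8 ≤ t) (h1 : t ≤ 6.4) :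
    deriv (fun t => riemannZeta (lineMap t)) t ≠ 0 := by
  rw [(hasDerivAt_riemannZeta_lineMap t).deriv, lineMap_eq_mk]
  exact mul_ne_zero Complex.I_ne_zero (deriv_riemannZeta_ne_zero h0 h1)

/-- Differentiating the conjugation symmetry of zeta transfers nonvanishing from `τ` to `-τ`. -/
theorem deriv_riemannZeta_lineMap_neg (t : ℝ) : deriv (fun t => riemannZeta (lineMap t)) (-t) =
    -star (deriv (fun t => riemannZeta (lineMap t)) t) := by
  set F := fun t => riemannZeta (lineMap t) with hF
  have hsymm : F = fun u => star (F (-u)) := by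
    funext u
    simp only [hF, ← star_lineMap, Complex.star_def, riemannZeta_conj, Complex.conj_conj]
  have h := (analyticAt_riemannZeta_lineMap t).differentiableAt.hasDerivAt
  rw [← neg_neg t] at h
  have h2 := (HasDerivAt.scomp (-t) h (hasDerivAt_neg (-t))).star
  conv_lhs => rw [hsymm]
  simpa [Function.comp_def] using! h2.deriv

/-! ### Conclusion for the zeta function -/

theorem countable_selfIntersections_lineMap :
    {x : ℝ × ℝ | x.1 ≠ x.2 ∧ riemannZeta (lineMap x.1) = riemannZeta (lineMap x.2)}.Countable := by
  obtain ⟨τ, ⟨hτ0, hτ1⟩, hτ⟩ := exists_deriv_riemannSiegelTheta_eq_zero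
  have hdτ := deriv_riemannZeta_lineMap_ne_zero hτ0.le hτ1.le
  have hpos (t : ℝ) (ht : τ < t) : 0 < deriv riemannSiegelTheta t :=
    hτ ▸ deriv_riemannSiegelTheta_lt (by linarith) ht
  refine countable_selfIntersections_of_phase (F := fun t => riemannZeta (lineMap t))
    (θ := riemannSiegelTheta) (p := -τ) (q := τ) analyticAt_riemannZeta_lineMap
    analyticAt_riemannSiegelTheta (by linarith) (fun t ht => ?_) (fun t ht => ?_) hpos
    (by rw [deriv_riemannSiegelTheta_neg, hτ]) hτ tendsto_riemannSiegelTheta_atBot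
    tendsto_riemannSiegelTheta_atTop ?_ hdτ fun a b hab ha => ?_
  · rw [← deriv_riemannSiegelTheta_neg]
    exact hpos _ (by linarith)
  · have habs : deriv riemannSiegelTheta t = deriv riemannSiegelTheta |t| := by
      rcases abs_choice t with h | h <;> rw [h]
      rw [deriv_riemannSiegelTheta_neg]
    rw [habs, ← hτ]
    exact deriv_riemannSiegelTheta_lt (abs_nonneg t) (abs_lt.2 ht)
  · rw [deriv_riemannZeta_lineMap_neg]
    exact neg_ne_zero.2 (star_ne_zero.2 hdτ)
  · refine (hasPhase_Gammaℝ a).eq_add_int_mul_pi (hasPhase_Gammaℝ b) ha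
      (im_Gammaℝ_mul_riemannZeta a) ?_
    rw [hab]
    exact im_Gammaℝ_mul_riemannZeta b

theorem theorem1 :
    zetaSelfIntersections.Countable ∧
      {z : ℂ | ¬ {t : ℝ | riemannZeta (1 / 2 + Complex.I * (t : ℂ)) = z}.Subsingleton}.Countable := by
  have hcount := countable_selfIntersections_lineMap
  constructor
  · refine (hcount.image fun x => (lineMap x.1, lineMap x.2)).mono ?_
    rintro ⟨s, w⟩ ⟨hs, hw, hne, hζ⟩
    have e {u : ℂ} (hu : u ∈ criticalLine) : lineMap u.im = u := by
      rw [lineMap_eq_mk]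
      exact Complex.ext hu.symm rfl
    refine ⟨(s.im, w.im), ⟨fun h => hne ?_, ?_⟩, ?_⟩
    · dsimp only at h hs hw ⊢
      rw [← e hs, ← e hw, h]
    · dsimp only at hs hw hζ ⊢
      rw [e hs, e hw, hζ]
    · dsimp only at hs hw ⊢
      rw [e hs, e hw]
  · refine (hcount.image fun x => riemannZeta (lineMap x.1)).mono ?_
    intro z hz
    obtain ⟨a, ha, b, hb, hab⟩ := Set.not_subsingleton_iff.1 hz
    exact ⟨(a, b), ⟨hab, Eq.trans ha (Eq.symm hb)⟩, ha⟩
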